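/- **Conventions.** An undirected graph $G$ consists of finite sets $A_G$ (arcs), $D_G$, $V_G$ (vertices), a fixpoint-free involution $\dagger$ on $A_G$, an injection $D_G\hookrightarrow A_G$ and a map $t\colon D_G\to V_G$. Its boundary is $\eth(G)=A_G\setminus D_G$, and its set of edges is $E_G=A_G/\dagger$. It is connected if it is non-empty and is not a coproduct of two non-empty graphs. An étale map is a natural transformation of such diagrams whose square over $D\to V$ is a pullback. An embedding is an étale map between connected graphs that is injective on vertices. $\operatorname{Emb}(G)$ is the set of embeddings with codomain $G$ up to isomorphism over $G$, ordered by $[h]\le[\ell]$ if $h$ factors through $\ell$; $[h]$ is an edge if its domain has no vertex. For $h\colon H\rightarrowtail G$ put $\eth[h]=h(\eth(H))\subseteq A_G$. An element $[\ell]$ is a union of $[h]$ and $[k]$ if $[h],[k]\le[\ell]$ and $\ell(V_L)=h(V_H)\cup k(V_K)$; and $[h],[k]$ are vertex disjoint if $h(V_H)\cap k(V_K)=\varnothing$. $\mathbb N S$ is the free commutative monoid on $S$, and finite subsets of $S$ are viewed as elements of $\mathbb N S$. The graphical category $\mathbf U$ has as objects the connected undirected graphs; a morphism $G\to G'$ is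 a pair $(\varphi_0,\hat\varphi)$ of an involutive function $\varphi_0\colon A_G\to A_{G'}$ and a function $\hat\varphi\colon\operatorname{Emb}(G)\to\operatorname{Emb}(G')$ which sends edges to edges, preserves unions, takes vertex disjoint pairs to vertex disjoint pairs, and satisfies $\eth\circ\hat\varphi=\mathbb N\varphi_0\circ\eth$. Composition is composition of pairs. The orientation presheaf $\mathfrak o$ on $\mathbf U$ is $\mathfrak o_G=\{x\colon A_G\to\{\pm1\}\mid x_{a}=-x_{a^\dagger}\}$, with $\varphi^*(x)_a=x_{\varphi_0(a)}$. The objects of $\mathbf U_{/\mathfrak o}$ are pairs $(G,x)$ with $G\in\mathbf U$, $x\in\mathfrak o_G$, and its morphisms $(G,x)\to(G',x')$ are the $\varphi\colon G\to G'$ in $\mathbf U$ with $\varphi^*x'=x$. Such a morphism induces $\bar\varphi_0\colon E_G\to E_{G'}$. A directed graph is a diagram $E\hookleftarrow I\to V\leftarrow O\hookrightarrow E$ of finite sets; the elements of $I$ (resp. $O$) over $v\in V$ are the inputs (resp. outputs) of $v$, and $E\setminus O$ and $E\setminus I$ are the inputs and outputs of the graph. Connectedness is defined as above. A pair $(G,x)$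 is regarded as a connected directed graph with $E=E_G$, $I=\{d\in D_G: x_d=-1\}$, $O=\{d\in D_G: x_d=+1\}$, $V=V_G$. A connected directed graph $L$ is linear if each vertex has exactly one input and one output and $L$ has exactly one input and one output. A connected directed graph is acyclic if there is no map of diagrams from a linear graph with at least one vertex to it that takes the same value on the input edge and the output edge. Let $G=(G,x)$ be an acyclic directed graph. An embedding $h\colon H\rightarrowtail G$ (with $H$ directed by $h^*x$) is a convex inclusion if it is injective and has the right lifting property, among maps of directed graphs (of diagrams), with respect to the maps $\downarrow\amalg\downarrow\;\to L$ that pick out the input and the output edge of a linear graph $L$ (here $\downarrow$ is the directed graph with one edge and no vertex). The set $\operatorname{sSb}(G)\subseteq\operatorname{Emb}(G)$ of structured subgraphs consists of the classes of convex inclusions. A structured subgraph is identified with its sets of edges and vertices in $G$, and $H_1\cup H_2$ denotes the union of edge sets and of vertex sets. For $[h]\in\operatorname{Emb}(G)$, $\operatorname{in}[h]$ and $\operatorname{out}[h]\subseteq E_G$ are the sets of edges spanned by the $a\in\eth[h]$ with $x_a=+1$ and $x_a=-1$, respectively. The properadic graphical category $\mathbf G$ has as objects the acyclic directed graphs; a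 morphism $G\to G'$ is a pair of functions $\bar\varphi_0\colon E_G\to E_{G'}$ and $\check\varphi\colon\operatorname{sSb}(G)\to\operatorname{sSb}(G')$ such that $\operatorname{in}\circ\check\varphi=\mathbb N\bar\varphi_0\circ\operatorname{in}$, $\operatorname{out}\circ\check\varphi=\mathbb N\bar\varphi_0\circ\operatorname{out}$, and $\check\varphi(H_1\cup H_2)=\check\varphi(H_1)\cup\check\varphi(H_2)$ whenever $H_1,H_2,H_1\cup H_2\in\operatorname{sSb}(G)$. Composition is composition of pairs. **Theorem.** The acyclic directed graphs together with the morphisms $\varphi\colon G\to G'$ of $\mathbf U_{/\mathfrak o}$ between them such that $\hat\varphi(G):=\hat\varphi([\mathrm{id}_G])\in\operatorname{sSb}(G')$ form a subcategory $\mathbf M$ of $\mathbf U_{/\mathfrak o}$ (that is, these morphisms contain the identities and are closed under composition). For every morphism $\varphi$ of $\mathbf M$ the function $\hat\varphi$ restricts to a function $\check\varphi=\hat\varphi|_{\operatorname{sSb}(G)}\colon\operatorname{sSb}(G)\to\operatorname{sSb}(G')$, and $(\bar\varphi_0,\hat\varphi)\mapsto(\bar\varphi_0,\check\varphi)$ is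 an identity-on-objects isomorphism of categories $\mathbf M\cong\mathbf G$. -/

import Mathlib

open CategoryTheory Opposite

universe u

namespace GraphCat

/-! ### Undirected graphs, étale maps, embeddings -/

/-- A (Feynman) graph: finite sets of arcs `A`, of half-edges at vertices `D`, and of vertices `V`,
with a fixed-point-free involution on `A`, an injection `D → A` and a map `D → V`. -/
structure Graph where
  A : Type u
  D : Type u
  V : Type u
  finA : Finite A
  finD : Finite D
  finV : Finite V
  inv : A → A
  inv_inv : ∀ a, inv (inv a) = a
  inv_ne : ∀ a, inv a ≠ a
  incl : D → A
  incl_inj : Function.Injective incl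
  t : D → V

namespace Graph

/-- The boundary `A ∖ D`. -/
def boundary (G : Graph.{u}) : Set G.A := {a | a ∉ Set.range G.incl}

/-- `G` is non-empty and in every coproduct splitting of `G` one of the summands is empty. A
splitting is given by the arcs and the vertices of one summand, the rest being the other. -/
def Connected (G : Graph.{u}) : Prop :=
  (Nonempty G.A ∨ Nonempty G.V) ∧
  ∀ (S : Set G.A) (T : Set G.V),
    (∀ a, G.inv a ∈ S ↔ a ∈ S) → (∀ d, G.incl d ∈ S ↔ G.t d ∈ T) →
    (S = ∅ ∧ T = ∅) ∨ (S = Set.univ ∧ T = Set.univ)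

/-- Two arcs span the same edge when they lie in the same orbit of the involution. -/
def edgeSetoid (G : Graph.{u}) : Setoid G.A where
  r a b := a = b ∨ a = G.inv b
  iseqv :=
    { refl := fun a => Or.inl rfl
      symm := by
        rintro a b (h | h)
        · exact Or.inl h.symm
        · exact Or.inr (by rw [h, G.inv_inv])
      trans := by
        rintro a b c (rfl | rfl) (rfl | rfl)
        · exact Or.inl rfl
        · exact Or.inr rfl
        · exact Or.inr rfl
        · exact Or.inl (G.inv_inv c) }

/-- The set of edges of `G`: the orbits of the involution on arcs. -/
def Edge (G : Graph.{u}) : Type u := Quotient G.edgeSetoid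

/-- The edge spanned by an arc. -/
def Edge.mk (G : Graph.{u}) (a : G.A) : G.Edge := Quotient.mk G.edgeSetoid a

/-- The map on edges induced by an involutive map on arcs. -/
def Edge.map {G H : Graph.{u}} (f : G.A → H.A) (hf : ∀ a, f (G.inv a) = H.inv (f a)) :
    G.Edge → H.Edge :=
  Quotient.map f (by
    rintro a b (rfl | rfl)
    · exact Or.inl rfl
    · exact Or.inr (hf b))

/-- Étale maps: natural transformations whose square over `D → V` is a pullback. -/
@[ext]
structure Etale (G H : Graph.{u}) where
  fA : G.A → H.A
  fD : G.D → H.D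
  fV : G.V → H.V
  comm_inv : ∀ a, fA (G.inv a) = H.inv (fA a)
  comm_incl : ∀ d, fA (G.incl d) = H.incl (fD d)
  comm_t : ∀ d, fV (G.t d) = H.t (fD d)
  pullback : ∀ (v : G.V) (d' : H.D), H.t d' = fV v → ∃! d : G.D, G.t d = v ∧ fD d = d'

instance : Category.{u} Graph.{u} where
  Hom := Etale
  id G :=
    { fA := id, fD := id, fV := id
      comm_inv := fun _ => rfl
      comm_incl := fun _ => rfl
      comm_t := fun _ => rfl
      pullback := fun v d' h => ⟨d', ⟨h, rfl⟩, fun _ hy => hy.2⟩ }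
  comp f g :=
    { fA := g.fA ∘ f.fA, fD := g.fD ∘ f.fD, fV := g.fV ∘ f.fV
      comm_inv := fun a => by simp [f.comm_inv, g.comm_inv]
      comm_incl := fun a => by simp [f.comm_incl, g.comm_incl]
      comm_t := fun a => by simp [f.comm_t, g.comm_t]
      pullback := by
        intro v d'' h
        obtain ⟨d', ⟨h1, h2⟩, h3⟩ := g.pullback (f.fV v) d'' h
        obtain ⟨d, ⟨h4, h5⟩, h6⟩ := f.pullback v d' h1
        refine ⟨d, ⟨h4, by simp [h5, h2]⟩, ?_⟩
        rintro y ⟨hy1, hy2⟩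
        exact h6 y ⟨hy1, h3 _ ⟨by rw [← f.comm_t, hy1], hy2⟩⟩ }

end Graph

/-- An embedding into `G`: an étale map from a connected graph, injective on vertices. -/
structure EmbRep (G : Graph.{u}) where
  dom : Graph.{u}
  conn : dom.Connected
  map : dom ⟶ G
  inj : Function.Injective map.fV

/-- Embeddings are identified when they are isomorphic over `G`. -/
def embSetoid (G : Graph.{u}) : Setoid (EmbRep G) where
  r f h := ∃ z : f.dom ≅ h.dom, z.hom ≫ h.map = f.map
  iseqv :=
    { refl := fun f => ⟨Iso.refl _, Category.id_comp _⟩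
      symm := by
        rintro f h ⟨z, hz⟩
        exact ⟨z.symm, by rw [← hz]; simp⟩
      trans := by
        rintro f h k ⟨z, hz⟩ ⟨w, hw⟩
        exact ⟨z.trans w, by simp [hw, hz]⟩ }

/-- The set `Emb(G)` of isomorphism classes of embeddings into `G`. -/
def Emb (G : Graph.{u}) : Type (u + 1) := Quotient (embSetoid G)

/-- The image in `A_G` of the boundary of the domain. -/
def EmbRep.bdry {G : Graph.{u}} (f : EmbRep G) : Set G.A := f.map.fA '' f.dom.boundary

theorem EmbRep.bdry_subset {G : Graph.{u}} {f h : EmbRep G} (z : f.dom ≅ h.dom)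
    (hz : z.hom ≫ h.map = f.map) : f.bdry ⊆ h.bdry := by
  rintro _ ⟨a, ha, rfl⟩
  refine ⟨z.hom.fA a, ?_, by rw [← hz]; rfl⟩
  rintro ⟨d, hd⟩
  apply ha
  refine ⟨z.inv.fD d, ?_⟩
  rw [← z.inv.comm_incl, hd]
  exact congrFun (congrArg Graph.Etale.fA z.hom_inv_id) a

theorem EmbRep.range_fA_subset {G : Graph.{u}} {f h : EmbRep G} (z : f.dom ≅ h.dom)
    (hz : z.hom ≫ h.map = f.map) : Set.range f.map.fA ⊆ Set.range h.map.fA := by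
  rintro _ ⟨a, rfl⟩
  exact ⟨z.hom.fA a, by rw [← hz]; rfl⟩

theorem EmbRep.range_fV_subset {G : Graph.{u}} {f h : EmbRep G} (z : f.dom ≅ h.dom)
    (hz : z.hom ≫ h.map = f.map) : Set.range f.map.fV ⊆ Set.range h.map.fV := by
  rintro _ ⟨a, rfl⟩
  exact ⟨z.hom.fV a, by rw [← hz]; rfl⟩

namespace Emb

variable {G : Graph.{u}}

/-- The class of an embedding. -/
def mk (f : EmbRep G) : Emb G := Quotient.mk (embSetoid G) f

/-- The class of the identity of a connected graph. -/
def top (G : Graph.{u}) (hG : G.Connected) : Emb G :=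
  mk ⟨G, hG, 𝟙 G, fun _ _ h => h⟩

/-- The boundary `ð([f]) ⊆ A_G`. -/
def bdry : Emb G → Set G.A :=
  Quotient.lift EmbRep.bdry (by
    rintro f h ⟨z, hz⟩
    exact (EmbRep.bdry_subset z hz).antisymm
      (EmbRep.bdry_subset z.symm (by rw [← hz]; simp)))

/-- The set of arcs of `G` in the image of the embedding. -/
def arcs : Emb G → Set G.A :=
  Quotient.lift (fun f => Set.range f.map.fA) (by
    rintro f h ⟨z, hz⟩
    exact (EmbRep.range_fA_subset z hz).antisymm
      (EmbRep.range_fA_subset z.symm (by rw [← hz]; simp)))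

/-- The set `ς([f])` of vertices of `G` in the image of the embedding. -/
def verts : Emb G → Set G.V :=
  Quotient.lift (fun f => Set.range f.map.fV) (by
    rintro f h ⟨z, hz⟩
    exact (EmbRep.range_fV_subset z hz).antisymm
      (EmbRep.range_fV_subset z.symm (by rw [← hz]; simp)))

/-- An embedding is an edge when its domain is the graph `↕` with two arcs and no vertex; for a
connected domain this means that the domain has no vertex. -/
def IsEdge (e : Emb G) : Prop := e.verts = ∅

/-- The order on `Emb(G)`: `[h] ≤ [l]` when `h` factors through `l`. -/
protected def le (e e' : Emb G) : Prop :=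
  ∃ h l : EmbRep G, mk h = e ∧ mk l = e' ∧ ∃ g : h.dom ⟶ l.dom, g ≫ l.map = h.map

/-- `l` is a union of `h` and `k`. -/
def IsUnion (l h k : Emb G) : Prop :=
  h.le l ∧ k.le l ∧ l.verts = h.verts ∪ k.verts

/-- `h` and `k` are vertex disjoint. -/
def VertexDisjoint (h k : Emb G) : Prop := h.verts ∩ k.verts = ∅

end Emb

/-! ### The graphical category `U` -/

/-- An object of the graphical category `U`: a connected graph. -/
structure UGraph where
  graph : Graph.{u}
  conn : graph.Connected

/-- A map of connected graphs in `U`: an involutive map `arc` on arcs together with a map `hat` on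
embeddings. The condition `bdry` says that the square comparing `ð` with the map of free commutative
monoids induced by `arc` commutes: the finite sets `ð(h)` and `ð(hat h)`, seen as multisets without
repetition, correspond under `arc` exactly when `arc` restricts to a bijection between them. -/
@[ext]
structure UHom (G G' : UGraph.{u}) where
  arc : G.graph.A → G'.graph.A
  hat : Emb G.graph → Emb G'.graph
  arc_inv : ∀ a, arc (G.graph.inv a) = G'.graph.inv (arc a)
  edges : ∀ h, h.IsEdge → (hat h).IsEdge
  unions : ∀ l h k, Emb.IsUnion l h k → Emb.IsUnion (hat l) (hat h) (hat k)
  disjoint : ∀ h k, Emb.VertexDisjoint h k → Emb.VertexDisjoint (hat h) (hat k)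
  bdry : ∀ h, Set.BijOn arc h.bdry (hat h).bdry

instance : Category.{u + 1} UGraph.{u} where
  Hom := UHom
  id G :=
    { arc := id, hat := id
      arc_inv := fun _ => rfl
      edges := fun _ h => h
      unions := fun _ _ _ h => h
      disjoint := fun _ _ h => h
      bdry := fun _ => Set.bijOn_id _ }
  comp φ ψ :=
    { arc := ψ.arc ∘ φ.arc, hat := ψ.hat ∘ φ.hat
      arc_inv := fun a => by simp [φ.arc_inv, ψ.arc_inv]
      edges := fun h hh => ψ.edges _ (φ.edges h hh)
      unions := fun l h k hu => ψ.unions _ _ _ (φ.unions l h k hu)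
      disjoint := fun h k hd => ψ.disjoint _ _ (φ.disjoint h k hd)
      bdry := fun h => (ψ.bdry (φ.hat h)).comp (φ.bdry h) }

/-! ### Orientations and the oriented graphical category -/

/-- An orientation of `G`: a choice of signs `x_a ∈ {1, -1}` with `x_a = - x_{a†}`. -/
@[ext]
structure Orientation (G : Graph.{u}) : Type u where
  sign : G.A → ℤˣ
  sign_inv : ∀ a, sign a = - sign (G.inv a)

/-- Pullback of an orientation along an involutive map on arcs. -/
def Orientation.pull {G H : Graph.{u}} (x : Orientation H) (f : G.A → H.A)
    (hf : ∀ a, f (G.inv a) = H.inv (f a)) : Orientation G :=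
  ⟨fun a => x.sign (f a), fun a => by rw [hf]; exact x.sign_inv (f a)⟩

/-- The orientation presheaf on `U`. -/
def orientationPresheaf : UGraph.{u}ᵒᵖ ⥤ Type u where
  obj G := Orientation G.unop.graph
  map φ := ↾fun x => Orientation.pull x φ.unop.arc φ.unop.arc_inv

/-- An object of the oriented graphical category `U/𝔬`, i.e. a connected directed graph: a connected
graph with an element of the orientation presheaf at it. -/
structure OGraph where
  U : UGraph.{u}
  orient : Orientation U.graph

/-- The underlying undirected graph. -/
abbrev OGraph.graph (X : OGraph.{u}) : Graph.{u} := X.U.graph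

/-- A map in `U/𝔬`: a map in `U` whose action on the orientation presheaf carries the orientation of
the codomain to that of the domain. -/
@[ext]
structure OHom (X Y : OGraph.{u}) where
  hom : X.U ⟶ Y.U
  orient : orientationPresheaf.map hom.op Y.orient = X.orient

instance : Category.{u + 1} OGraph.{u} where
  Hom := OHom
  id X := ⟨𝟙 X.U, rfl⟩
  comp {X Y Z} φ ψ := ⟨φ.hom ≫ ψ.hom, by
    rw [← φ.orient, ← ψ.orient]; rfl⟩

/-! ### Directed graphs as diagrams, paths and cycles -/

/-- A directed graph: a diagram `E ↩ I → V ← O ↪ E` of finite sets. -/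
structure DiGraph where
  E : Type u
  I : Type u
  O : Type u
  V : Type u
  finE : Finite E
  finI : Finite I
  finO : Finite O
  finV : Finite V
  sI : I → E
  sI_inj : Function.Injective sI
  sO : O → E
  sO_inj : Function.Injective sO
  tI : I → V
  tO : O → V

namespace DiGraph

/-- Maps of diagrams (natural transformations). -/
@[ext]
structure Hom (G H : DiGraph.{u}) where
  fE : G.E → H.E
  fI : G.I → H.I
  fO : G.O → H.O
  fV : G.V → H.V
  comm_sI : ∀ i, fE (G.sI i) = H.sI (fI i)
  comm_sO : ∀ o, fE (G.sO o) = H.sO (fO o)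
  comm_tI : ∀ i, fV (G.tI i) = H.tI (fI i)
  comm_tO : ∀ o, fV (G.tO o) = H.tO (fO o)

instance : Category.{u} DiGraph.{u} where
  Hom := Hom
  id G :=
    { fE := id, fI := id, fO := id, fV := id
      comm_sI := fun _ => rfl, comm_sO := fun _ => rfl
      comm_tI := fun _ => rfl, comm_tO := fun _ => rfl }
  comp f g :=
    { fE := g.fE ∘ f.fE, fI := g.fI ∘ f.fI, fO := g.fO ∘ f.fO, fV := g.fV ∘ f.fV
      comm_sI := fun i => by simp [f.comm_sI, g.comm_sI]
      comm_sO := fun i => by simp [f.comm_sO, g.comm_sO]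
      comm_tI := fun i => by simp [f.comm_tI, g.comm_tI]
      comm_tO := fun i => by simp [f.comm_tO, g.comm_tO] }

/-- The input edges `E ∖ O` of a directed graph. -/
def inputs (G : DiGraph.{u}) : Set G.E := {e | e ∉ Set.range G.sO}

/-- The output edges `E ∖ I` of a directed graph. -/
def outputs (G : DiGraph.{u}) : Set G.E := {e | e ∉ Set.range G.sI}

/-- `G` is non-empty and in every coproduct splitting of `G` one of the summands is empty. -/
def Connected (G : DiGraph.{u}) : Prop :=
  (Nonempty G.E ∨ Nonempty G.V) ∧
  ∀ (S : Set G.E) (T : Set G.V),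
    (∀ i, G.sI i ∈ S ↔ G.tI i ∈ T) → (∀ o, G.sO o ∈ S ↔ G.tO o ∈ T) →
    (S = ∅ ∧ T = ∅) ∨ (S = Set.univ ∧ T = Set.univ)

/-- Linear graphs: connected, with exactly one input and one output at each vertex, and exactly one
input and one output of the whole graph. -/
structure IsLinear (L : DiGraph.{u}) : Prop where
  conn : L.Connected
  in_vertex : ∀ v, ∃! i, L.tI i = v
  out_vertex : ∀ v, ∃! o, L.tO o = v
  input : ∃! e, e ∈ L.inputs
  output : ∃! e, e ∈ L.outputs

/-- `G` is acyclic: it is connected and has no directed cycle, a directed cycle being a map to `G`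
from a linear graph with at least one vertex that sends its input and its output to the same
edge. -/
def IsAcyclic (G : DiGraph.{u}) : Prop :=
  G.Connected ∧
  ∀ (L : DiGraph.{u}), L.IsLinear → Nonempty L.V → ∀ (p : L ⟶ G) (i o : L.E),
    i ∈ L.inputs → o ∈ L.outputs → p.fE i ≠ p.fE o

/-- A map `h : H ⟶ G` is convex if it is injective and has the right lifting property with respect
to the maps `↓ ⨿ ↓ ⟶ L` hitting the input `i` and the output `o` of a linear graph `L`. A square
from such a map to `h` consists of a path `p : L ⟶ G` and two edges `a`, `b` of `H` over the ends of
the path. -/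
structure IsConvex {H G : DiGraph.{u}} (h : H ⟶ G) : Prop where
  injE : Function.Injective h.fE
  injI : Function.Injective h.fI
  injO : Function.Injective h.fO
  injV : Function.Injective h.fV
  lift : ∀ (L : DiGraph.{u}), L.IsLinear → ∀ (i o : L.E), i ∈ L.inputs → o ∈ L.outputs →
    ∀ (p : L ⟶ G) (a b : H.E), h.fE a = p.fE i → h.fE b = p.fE o →
      ∃ q : L ⟶ H, q.fE i = a ∧ q.fE o = b ∧ q ≫ h = p

/-- An unstructured subgraph: sets of edges and vertices, containing with each vertex all inputs and
outputs of that vertex. -/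
@[ext]
structure Subgraph (G : DiGraph.{u}) where
  edges : Set G.E
  verts : Set G.V
  closed_in : ∀ i, G.tI i ∈ verts → G.sI i ∈ edges
  closed_out : ∀ o, G.tO o ∈ verts → G.sO o ∈ edges

/-- The union of unstructured subgraphs. -/
instance (G : DiGraph.{u}) : Union G.Subgraph where
  union H K :=
    { edges := H.edges ∪ K.edges
      verts := H.verts ∪ K.verts
      closed_in := fun i h => h.imp (H.closed_in i) (K.closed_in i)
      closed_out := fun o h => h.imp (H.closed_out o) (K.closed_out o) }

end DiGraph

/-! ### The directed graph of an oriented graph -/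

/-- The directed graph of a graph with an orientation: `E` is the set of edges, the inputs of
vertices are the `d ∈ D` with `x_d = -1` and the outputs of vertices those with `x_d = 1`. -/
def toDi (G : Graph.{u}) (x : Orientation G) : DiGraph.{u} where
  E := G.Edge
  I := {d : G.D // x.sign (G.incl d) = -1}
  O := {d : G.D // x.sign (G.incl d) = 1}
  V := G.V
  finE := by
    have := G.finA
    exact Quotient.finite _
  finI := by
    have := G.finD
    infer_instance
  finO := by
    have := G.finD
    infer_instance
  finV := G.finV
  sI d := Graph.Edge.mk G (G.incl d.1)
  sI_inj := by
    rintro ⟨d, hd⟩ ⟨d', hd'⟩ h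
    rcases Quotient.exact h with h | h
    · exact Subtype.ext (G.incl_inj h)
    · exfalso
      have h2 := x.sign_inv (G.incl d')
      rw [← h, hd, hd'] at h2
      exact absurd h2 (by decide)
  sO d := Graph.Edge.mk G (G.incl d.1)
  sO_inj := by
    rintro ⟨d, hd⟩ ⟨d', hd'⟩ h
    rcases Quotient.exact h with h | h
    · exact Subtype.ext (G.incl_inj h)
    · exfalso
      have h2 := x.sign_inv (G.incl d')
      rw [← h, hd, hd'] at h2
      exact absurd h2 (by decide)
  tI d := G.t d.1
  tO d := G.t d.1

/-- The map of directed graphs given by an étale map `f : H ⟶ G` and an orientation `x` of `G`; its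
domain carries the pulled back orientation. -/
def toDiMap {H G : Graph.{u}} (f : H ⟶ G) (x : Orientation G) :
    toDi H (x.pull f.fA f.comm_inv) ⟶ toDi G x where
  fE := Graph.Edge.map f.fA f.comm_inv
  fI d := ⟨f.fD d.1, by rw [← f.comm_incl]; exact d.2⟩
  fO d := ⟨f.fD d.1, by rw [← f.comm_incl]; exact d.2⟩
  fV := f.fV
  comm_sI d := congrArg (Graph.Edge.mk G) (f.comm_incl d.1)
  comm_sO d := congrArg (Graph.Edge.mk G) (f.comm_incl d.1)
  comm_tI d := f.comm_t d.1
  comm_tO d := f.comm_t d.1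

namespace OGraph

variable (X : OGraph.{u})

/-- The directed graph of an object of `U/𝔬`. -/
abbrev di : DiGraph.{u} := toDi X.graph X.orient

/-- The set of structured subgraphs of `X`: the classes of embeddings which are represented by
convex inclusions. -/
def sSb : Set (Emb X.graph) :=
  {e | ∃ h : EmbRep X.graph, Emb.mk h = e ∧ DiGraph.IsConvex (toDiMap h.map X.orient)}

/-- The inputs of an embedding: the edges spanned by its boundary arcs of sign `1`. -/
def inp (e : Emb X.graph) : Set X.graph.Edge :=
  Graph.Edge.mk X.graph '' {a | a ∈ e.bdry ∧ X.orient.sign a = 1}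

/-- The outputs of an embedding: the edges spanned by its boundary arcs of sign `-1`. -/
def out (e : Emb X.graph) : Set X.graph.Edge :=
  Graph.Edge.mk X.graph '' {a | a ∈ e.bdry ∧ X.orient.sign a = -1}

/-- The unstructured subgraph which is the image of an embedding. -/
def image (e : Emb X.graph) : X.di.Subgraph where
  edges := Graph.Edge.mk X.graph '' e.arcs
  verts := e.verts
  closed_in := by
    induction e using Quotient.inductionOn with
    | h f =>
      rintro ⟨d, hd⟩ ⟨v, hv⟩
      obtain ⟨d', ⟨-, h2⟩, -⟩ := f.map.pullback v d hv.symm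
      exact ⟨_, ⟨f.dom.incl d', rfl⟩, by rw [f.map.comm_incl, h2]; rfl⟩
  closed_out := by
    induction e using Quotient.inductionOn with
    | h f =>
      rintro ⟨d, hd⟩ ⟨v, hv⟩
      obtain ⟨d', ⟨-, h2⟩, -⟩ := f.map.pullback v d hv.symm
      exact ⟨_, ⟨f.dom.incl d', rfl⟩, by rw [f.map.comm_incl, h2]; rfl⟩

/-- The acyclic objects of `U/𝔬`. -/
def acyclic : ObjectProperty OGraph.{u} := fun X => X.di.IsAcyclic

end OGraph

/-! ### The properadic graphical category `G` -/

/-- An object of the properadic graphical category: an acyclic directed graph. -/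
structure AcyclicGraph where
  graph : OGraph.{u}
  acyclic : OGraph.acyclic graph

/-- A map in the properadic graphical category: a map `edge` on edges together with a map `check` on
structured subgraphs. The conditions `inp` and `out` say, as for maps in `U`, that inputs and
outputs correspond as multisets without repetition. A structured subgraph is identified with the
unstructured subgraph which is its image, and `H₁ ∪ H₂` is a structured subgraph when it is the
image of some structured subgraph `J`. -/
@[ext]
structure GHom (X Y : AcyclicGraph.{u}) where
  edge : X.graph.graph.Edge → Y.graph.graph.Edge
  check : X.graph.sSb → Y.graph.sSb
  inp : ∀ H : X.graph.sSb, Set.BijOn edge (X.graph.inp H) (Y.graph.inp (check H))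
  out : ∀ H : X.graph.sSb, Set.BijOn edge (X.graph.out H) (Y.graph.out (check H))
  union : ∀ H₁ H₂ J : X.graph.sSb, X.graph.image J = X.graph.image H₁ ∪ X.graph.image H₂ →
    Y.graph.image (check J) = Y.graph.image (check H₁) ∪ Y.graph.image (check H₂)

/-- The properadic graphical category; composition is composition of pairs of functions. -/
instance : Category.{u + 1} AcyclicGraph.{u} where
  Hom := GHom
  id X :=
    { edge := id, check := id
      inp := fun _ => Set.bijOn_id _
      out := fun _ => Set.bijOn_id _
      union := fun _ _ _ h => h }
  comp φ ψ :=
    { edge := ψ.edge ∘ φ.edge, check := ψ.check ∘ φ.check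
      inp := fun H => (ψ.inp _).comp (φ.inp H)
      out := fun H => (ψ.out _).comp (φ.out H)
      union := fun H₁ H₂ J h => ψ.union _ _ _ (φ.union H₁ H₂ J h) }

/-! ### The comparison -/

/-- The maps `φ : X ⟶ Y` of `U/𝔬` between acyclic directed graphs for which `φ̂(X) = φ̂([id_X])` is a
structured subgraph of `Y`. -/
def structuredMaps : MorphismProperty OGraph.acyclic.{u}.FullSubcategory :=
  fun X Y φ => φ.hom.hom.hat (Emb.top X.obj.graph X.obj.U.conn) ∈ Y.obj.sSb

/-- The properadic map `ψ` is the restriction of the map `φ` of `U/𝔬`: they agree on edges and on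
structured subgraphs. -/
structure IsRestriction {X Y : AcyclicGraph.{u}} (φ : X.graph ⟶ Y.graph) (ψ : X ⟶ Y) : Prop where
  edge : ψ.edge = Graph.Edge.map φ.hom.arc φ.hom.arc_inv
  check : ∀ H : X.graph.sSb, (ψ.check H : Emb Y.graph.graph) = φ.hom.hat H

/-- An acyclic object of `U/𝔬` as an object of the properadic graphical category. -/
def AcyclicGraph.ofObj (X : OGraph.acyclic.{u}.FullSubcategory) : AcyclicGraph.{u} :=
  ⟨X.obj, X.property⟩

end GraphCat

/-! An embedding is determined by the set `W` of its vertices and the set `B` of its boundary arcs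
in the codomain (`Emb.ext_verts_bdry`). The pairs that occur are described by `IsEmbData`; `B` may
contain both arcs of an edge between vertices of `W`, and then that edge is cut. Factorizations can
be read off from these sets, so everything becomes combinatorics of pairs `(W, B)`. In an acyclic
graph the structured subgraphs are the embeddings that cut no edge between their vertices and whose
vertices are closed under directed paths (`OGraph.mem_sSb_iff`).

A map of `U` sends the vertices of `h` to the union of the images of the stars in `h`, so it is
determined by its arc map and its values on stars. If the image of the whole graph is structured, a
directed path inside it lifts to the source: edges inside the image of a star lift trivially, and an
edge leaving it comes from a boundary arc of that star. Stars that collapse to edges are crossed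
until a star with a nonempty image is met, which happens by acyclicity. Fullness and convexity
therefore pass from `H` to its image (`OHom.hat_mem_sSb`). This gives closure under composition and
the restriction functor, which is faithful because stars are structured and signs recover arcs from
edges.

Conversely, a properadic map lifts to arcs by signs, and it has to be extended to embeddings that
are not structured. Every embedding arises from a star by attaching stars along an edge and gluing
pairs of boundary arcs (`Emb.induction_of_le`), and both operations can be imitated in the target
(`StarMap.IsImage.attach`, `StarMap.IsImage.glue`). The one obstruction, gluing the two ends of a
bare edge, is excluded by acyclicity (`StarMap.IsImage.nonempty_of_glue`). Substitution also needs
distinct stars to have vertex disjoint images, which is not part of the definition of a properadic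
map. It follows for two disjoint structured subgraphs with structured union from fullness and the
bijections of boundaries (`GHom.verts_check_inter`), and in general by repeatedly splitting the
graph into two such pieces (`OGraph.exists_split`). -/

namespace GraphCat

/-! ### Half-edges at a set of vertices, and the data (W, B) of an embedding -/

namespace Graph

variable {G : Graph.{u}}

/-- The arcs of `G` which are half-edges at a vertex in `W`. -/
def att (G : Graph.{u}) (W : Set G.V) : Set G.A := {a | ∃ d, G.incl d = a ∧ G.t d ∈ W}

theorem incl_mem_att {W : Set G.V} {d : G.D} : G.incl d ∈ G.att W ↔ G.t d ∈ W :=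
  ⟨fun ⟨_, h, h'⟩ => G.incl_inj h ▸ h', fun h => ⟨d, rfl, h⟩⟩

theorem att_mono {W W' : Set G.V} (h : W ⊆ W') : G.att W ⊆ G.att W' :=
  fun _ ⟨d, hd, hd'⟩ => ⟨d, hd, h hd'⟩

theorem att_union {W W' : Set G.V} {a : G.A} :
    a ∈ G.att (W ∪ W') ↔ a ∈ G.att W ∨ a ∈ G.att W' := by
  constructor
  · rintro ⟨d, rfl, h | h⟩
    · exact Or.inl ⟨d, rfl, h⟩
    · exact Or.inr ⟨d, rfl, h⟩
  · rintro (h | h)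
    · exact att_mono Set.subset_union_left h
    · exact att_mono Set.subset_union_right h

theorem att_inter {W W' : Set G.V} {a : G.A} (h : a ∈ G.att W) (h' : a ∈ G.att W') :
    a ∈ G.att (W ∩ W') := by
  obtain ⟨d, rfl, hd⟩ := h
  exact ⟨d, rfl, hd, incl_mem_att.1 h'⟩

theorem not_mem_att_empty {a : G.A} : a ∉ G.att ∅ := fun ⟨_, _, h⟩ => h

theorem inv_eq_iff {a b : G.A} : G.inv a = b ↔ a = G.inv b :=
  ⟨fun h => by rw [← h, G.inv_inv], fun h => by rw [h, G.inv_inv]⟩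

theorem Connected.incl_or (hG : G.Connected) (hV : Nonempty G.V) (a : G.A) :
    a ∈ Set.range G.incl ∨ G.inv a ∈ Set.range G.incl := by
  by_contra hc
  push Not at hc
  rcases hG.2 {b | b = a ∨ b = G.inv a} ∅
    (fun b => by simp only [Set.mem_ofPred_eq, inv_eq_iff, or_comm, G.inv_inv])
    (fun d => iff_of_false (Or.rec (fun h => hc.1 ⟨d, h⟩) (fun h => hc.2 ⟨d, h⟩)) id) with h | h
  · exact (h.1 ▸ (Or.inl rfl : a ∈ {b | b = a ∨ b = G.inv a}) : a ∈ (∅ : Set G.A))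
  · exact (h.2 ▸ Set.mem_univ hV.some : hV.some ∈ (∅ : Set G.V))

theorem Connected.eq_or_eq_inv (hG : G.Connected) (hV : IsEmpty G.V) (a b : G.A) :
    b = a ∨ b = G.inv a := by
  rcases hG.2 {b | b = a ∨ b = G.inv a} ∅
    (fun b => by simp only [Set.mem_ofPred_eq, inv_eq_iff, or_comm, G.inv_inv])
    (fun d => (hV.false (G.t d)).elim) with h | h
  · exact ((h.1 ▸ (Or.inl rfl : a ∈ {b | b = a ∨ b = G.inv a}) : a ∈ (∅ : Set G.A))).elim
  · exact (h.1 ▸ Set.mem_univ b : b ∈ {b | b = a ∨ b = G.inv a})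

/-- The pairs of a set of vertices `W` and a set of arcs `B` which arise from embeddings whose
domain has a vertex, as the image of the vertices and the image of the boundary. -/
structure IsEmbData (G : Graph.{u}) (W : Set G.V) (B : Set G.A) : Prop where
  nonempty : W.Nonempty
  inv_mem : ∀ a ∈ B, G.inv a ∈ G.att W
  inner : ∀ a ∈ G.att W, G.inv a ∉ B → G.inv a ∈ G.att W ∧ a ∉ B
  conn : ∀ T ⊆ W, T.Nonempty →
    (∀ d d', G.t d ∈ T → G.t d' ∈ W → G.incl d' = G.inv (G.incl d) → G.incl d ∉ B → G.t d' ∈ T) →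
    T = W

/-- This is the contrapositive of `conn`, the form in which connectedness is used: a proper nonempty
part is left along an uncut edge. -/
theorem IsEmbData.exists_step {W T : Set G.V} {B : Set G.A} (h : G.IsEmbData W B) (hT : T ⊆ W)
    (hn : T.Nonempty) (hne : T ≠ W) :
    ∃ d d', G.t d ∈ T ∧ G.t d' ∈ W ∧ G.t d' ∉ T ∧ G.incl d' = G.inv (G.incl d) ∧
      G.incl d ∉ B := by
  by_contra hc
  push Not at hc
  refine hne (h.conn T hT hn fun d d' h1 h2 h3 h4 => ?_)
  by_contra h5
  exact h4 (hc d d' h1 h2 h5 h3)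

end Graph

open GraphCat.Graph

/-! ### The data of an embedding, and factorization criteria -/

namespace EmbRep

variable {G : Graph.{u}} (f : EmbRep G)

theorem fD_inj : Function.Injective f.map.fD := by
  intro d d' h
  have ht : f.dom.t d = f.dom.t d' := f.inj (by rw [f.map.comm_t, f.map.comm_t, h])
  exact (f.map.pullback (f.dom.t d) (f.map.fD d) (f.map.comm_t d).symm).unique ⟨rfl, rfl⟩
    ⟨ht.symm, h.symm⟩

theorem exists_fD {d : G.D} (h : G.t d ∈ Set.range f.map.fV) : ∃ d', f.map.fD d' = d := by
  obtain ⟨v, hv⟩ := h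
  obtain ⟨d', ⟨-, h'⟩, -⟩ := f.map.pullback v d hv.symm
  exact ⟨d', h'⟩

theorem fA_incl_mem (d : f.dom.D) : f.map.fA (f.dom.incl d) ∈ G.att (Set.range f.map.fV) :=
  ⟨_, (f.map.comm_incl d).symm, _, f.map.comm_t d⟩

theorem eq_of_fA_incl {d d' : f.dom.D}
    (h : f.map.fA (f.dom.incl d) = f.map.fA (f.dom.incl d')) : d = d' := by
  rw [f.map.comm_incl, f.map.comm_incl] at h
  exact f.fD_inj (G.incl_inj h)

theorem exists_incl {a : G.A} (h : a ∈ G.att (Set.range f.map.fV)) :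
    ∃ d, f.map.fA (f.dom.incl d) = a := by
  obtain ⟨d, rfl, hd⟩ := h
  obtain ⟨d', rfl⟩ := f.exists_fD hd
  exact ⟨d', f.map.comm_incl d'⟩

/-- On all arcs `fA` need not be injective, but it is on half-edges. A boundary arc with the same
image as `d` would be opposite to a half-edge with the same image as `d'`, hence to `d'` itself, so
it would equal the half-edge `d`. -/
theorem fA_incl_notMem_bdry (hV : Nonempty f.dom.V) {d d' : f.dom.D}
    (h : f.dom.incl d' = f.dom.inv (f.dom.incl d)) : f.map.fA (f.dom.incl d) ∉ f.bdry := by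
  rintro ⟨b, hb, hbe⟩
  rcases f.conn.incl_or hV b with h' | ⟨e, he⟩
  · exact hb h'
  · have : e = d' := f.eq_of_fA_incl (by rw [he, h, f.map.comm_inv, f.map.comm_inv, hbe])
    rw [this, h] at he
    exact hb ⟨d, by rw [← f.dom.inv_inv b, ← he, f.dom.inv_inv]⟩

theorem isEmbData (hV : Nonempty f.dom.V) : G.IsEmbData (Set.range f.map.fV) f.bdry where
  nonempty := Set.range_nonempty _
  inv_mem := by
    rintro _ ⟨a, ha, rfl⟩
    rcases f.conn.incl_or hV a with h | ⟨d, hd⟩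
    · exact (ha h).elim
    · rw [← f.map.comm_inv, ← hd]
      exact f.fA_incl_mem d
  inner := by
    intro a ha hB
    obtain ⟨d, rfl⟩ := f.exists_incl ha
    have h1 : f.dom.inv (f.dom.incl d) ∈ Set.range f.dom.incl := by
      by_contra h
      exact hB ⟨_, h, f.map.comm_inv _⟩
    obtain ⟨d', hd'⟩ := h1
    exact ⟨by rw [← f.map.comm_inv, ← hd']; exact f.fA_incl_mem d', f.fA_incl_notMem_bdry hV hd'⟩
  conn := by
    intro T hT hn hcl
    -- The splitting of the domain to be tested consists of the vertices over `T` and all edges with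
    -- an end at one of them.
    have key : ∀ a : f.dom.A,
        (∃ d, (f.dom.incl d = a ∨ f.dom.incl d = f.dom.inv a) ∧ f.map.fV (f.dom.t d) ∈ T) →
        ∀ d, f.dom.incl d = a → f.map.fV (f.dom.t d) ∈ T := by
      rintro a ⟨d, h1 | h1, h2⟩ d' h3
      · rwa [f.dom.incl_inj (h3.trans h1.symm)]
      · have h4 : G.incl (f.map.fD d') = G.inv (G.incl (f.map.fD d)) := by
          rw [← f.map.comm_incl, ← f.map.comm_incl, h3, h1, f.map.comm_inv, G.inv_inv]
        rw [f.map.comm_t] at h2 ⊢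
        refine hcl _ _ h2 ⟨_, f.map.comm_t d'⟩ h4 ?_
        rw [← f.map.comm_incl]
        exact f.fA_incl_notMem_bdry hV (d' := d') (by rw [h1, f.dom.inv_inv, h3])
    rcases f.conn.2 {a | ∃ d, (f.dom.incl d = a ∨ f.dom.incl d = f.dom.inv a) ∧
        f.map.fV (f.dom.t d) ∈ T} (f.map.fV ⁻¹' T)
        (fun a => by simp only [Set.mem_ofPred_eq, f.dom.inv_inv, or_comm])
        (fun d => ⟨fun h => key _ h d rfl, fun h => ⟨d, Or.inl rfl, h⟩⟩) with h | h
    · obtain ⟨w, hw⟩ := hn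
      obtain ⟨v, rfl⟩ := hT hw
      exact (Set.eq_empty_iff_forall_notMem.1 h.2 v hw).elim
    · refine hT.antisymm ?_
      rintro _ ⟨v, rfl⟩
      exact (h.2 ▸ Set.mem_univ v : v ∈ f.map.fV ⁻¹' T)

theorem range_fA (hV : Nonempty f.dom.V) (a : G.A) : a ∈ Set.range f.map.fA ↔
    a ∈ G.att (Set.range f.map.fV) ∨ G.inv a ∈ G.att (Set.range f.map.fV) := by
  constructor
  · rintro ⟨b, rfl⟩
    rcases f.conn.incl_or hV b with ⟨d, rfl⟩ | ⟨d, hd⟩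
    · exact Or.inl (f.fA_incl_mem d)
    · refine Or.inr ?_
      rw [← f.map.comm_inv, ← hd]
      exact f.fA_incl_mem d
  · rintro (h | h)
    · obtain ⟨d, rfl⟩ := f.exists_incl h
      exact ⟨_, rfl⟩
    · obtain ⟨d, hd⟩ := f.exists_incl h
      exact ⟨f.dom.inv (f.dom.incl d), by rw [f.map.comm_inv, hd, G.inv_inv]⟩

theorem exists_edge (hV : IsEmpty f.dom.V) :
    ∃ a, f.bdry = {a, G.inv a} ∧ Set.range f.map.fA = {a, G.inv a} := by
  obtain ⟨a⟩ : Nonempty f.dom.A := f.conn.1.resolve_right (not_nonempty_iff.2 hV)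
  have hr : Set.range f.map.fA = {f.map.fA a, G.inv (f.map.fA a)} := by
    ext b
    constructor
    · rintro ⟨c, rfl⟩
      rcases f.conn.eq_or_eq_inv hV a c with rfl | rfl
      · exact Or.inl rfl
      · exact Or.inr (f.map.comm_inv _)
    · rintro (rfl | rfl)
      · exact ⟨_, rfl⟩
      · exact ⟨_, f.map.comm_inv _⟩
  have hb : f.dom.boundary = Set.univ :=
    Set.eq_univ_of_forall fun a ⟨d, _⟩ => hV.false (f.dom.t d)
  exact ⟨f.map.fA a, by rw [bdry, hb, Set.image_univ, hr], hr⟩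

/-- An étale endomorphism over `G` of the domain of an embedding is the identity. -/
theorem eq_id (g : f.dom ⟶ f.dom) (hg : g ≫ f.map = f.map) : g = 𝟙 f.dom := by
  have hA : ∀ a, f.map.fA (g.fA a) = f.map.fA a := fun a => congrFun (congrArg Etale.fA hg) a
  have hD : ∀ a, f.map.fD (g.fD a) = f.map.fD a := fun a => congrFun (congrArg Etale.fD hg) a
  have hV : ∀ a, f.map.fV (g.fV a) = f.map.fV a := fun a => congrFun (congrArg Etale.fV hg) a
  have hD' : ∀ d, g.fD d = d := fun d => f.fD_inj (hD d)
  refine Etale.ext (funext fun a => ?_) (funext hD') (funext fun v => f.inj (hV v))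
  change g.fA a = a
  rcases isEmpty_or_nonempty f.dom.V with h | h
  · rcases f.conn.eq_or_eq_inv h a (g.fA a) with h' | h'
    · exact h'
    · have := hA a
      rw [h', f.map.comm_inv] at this
      exact (G.inv_ne _ this).elim
  · rcases f.conn.incl_or h a with ⟨d, rfl⟩ | ⟨d, hd⟩
    · rw [g.comm_incl, hD']
    · have := g.comm_incl d
      rw [hD', hd, g.comm_inv] at this
      rw [← f.dom.inv_inv (g.fA a), this, f.dom.inv_inv]

/-- Factorization of embeddings whose domain has a vertex. -/
theorem exists_factor {h : EmbRep G} (hV : Nonempty f.dom.V)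
    (hW : Set.range f.map.fV ⊆ Set.range h.map.fV)
    (hB : ∀ a ∈ h.bdry, G.inv a ∈ G.att (Set.range f.map.fV) → a ∈ f.bdry) :
    ∃ g : f.dom ⟶ h.dom, g ≫ h.map = f.map := by
  choose gV hgV using fun v => hW ⟨v, rfl⟩
  choose gD hgD using fun d : f.dom.D => h.exists_fD (d := f.map.fD d)
    (by rw [← f.map.comm_t]; exact hW ⟨_, rfl⟩)
  have hgA : ∀ d, h.map.fA (h.dom.incl (gD d)) = f.map.fA (f.dom.incl d) := fun d => by
    rw [h.map.comm_incl, f.map.comm_incl, hgD]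
  -- The image of an arc is forced by the half-edge at either of its ends; for an inner edge the two
  -- prescriptions must agree.
  have key : ∀ a : f.dom.A, ∃ b : h.dom.A, h.map.fA b = f.map.fA a ∧
      (∀ d, f.dom.incl d = a → h.dom.incl (gD d) = b) ∧
      (∀ d, f.dom.incl d = f.dom.inv a → h.dom.incl (gD d) = h.dom.inv b) := by
    intro a
    by_cases ha : a ∈ Set.range f.dom.incl
    · obtain ⟨d, rfl⟩ := ha
      refine ⟨h.dom.incl (gD d), hgA d, fun d' hd' => by rw [f.dom.incl_inj hd'], ?_⟩
      intro d' hd'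
      -- If `h` cut this edge here, then by `hB` so would `f`, although both ends are half-edges of
      -- its domain.
      have hmem : h.dom.inv (h.dom.incl (gD d)) ∈ Set.range h.dom.incl := by
        by_contra hc
        have h1 : G.inv (f.map.fA (f.dom.incl d)) ∈ h.bdry :=
          ⟨_, hc, by rw [h.map.comm_inv, hgA]⟩
        have h2 := hB _ h1 (by rw [G.inv_inv]; exact f.fA_incl_mem d)
        exact f.fA_incl_notMem_bdry hV (d := d') (d' := d) (by rw [hd', f.dom.inv_inv])
          (by rwa [hd', f.map.comm_inv])
      obtain ⟨e, he⟩ := hmem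
      have : e = gD d' := h.eq_of_fA_incl (by
        rw [he, h.map.comm_inv, hgA, hgA, hd', f.map.comm_inv])
      rw [← this, he]
    · obtain ⟨d, hd⟩ := (f.conn.incl_or hV a).resolve_left ha
      refine ⟨h.dom.inv (h.dom.incl (gD d)), ?_, fun d' hd' => (ha ⟨d', hd'⟩).elim, ?_⟩
      · rw [h.map.comm_inv, hgA, hd, f.map.comm_inv, G.inv_inv]
      · intro d' hd'
        rw [h.dom.inv_inv, f.dom.incl_inj (hd.trans hd'.symm)]
  choose gA hg1 hg2 hg3 using key
  refine ⟨{ fA := gA, fD := gD, fV := gV, comm_inv := fun a => ?_, comm_incl := fun d => ?_,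
            comm_t := fun d => ?_, pullback := fun v d' hd' => ?_ }, ?_⟩
  · rcases f.conn.incl_or hV a with ⟨d, hd⟩ | ⟨d, hd⟩
    · have h1 := hg3 (f.dom.inv a) d (by rw [f.dom.inv_inv, hd])
      rw [← hg2 a d hd, h1, h.dom.inv_inv]
    · rw [← hg2 _ d hd, hg3 a d hd]
  · exact (hg2 _ d rfl).symm
  · apply h.inj
    rw [hgV, h.map.comm_t, hgD, f.map.comm_t]
  · obtain ⟨d, ⟨hd1, hd2⟩, -⟩ := f.map.pullback v (h.map.fD d')
      (by rw [← h.map.comm_t, hd', hgV])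
    refine ⟨d, ⟨hd1, h.fD_inj (by rw [hgD, hd2])⟩, ?_⟩
    rintro e ⟨-, he2⟩
    apply f.fD_inj
    rw [hd2, ← he2, hgD]
  · exact Etale.ext (funext hg1) (funext hgD) (funext hgV)

/-- Factorization of edges. -/
theorem exists_factor_of_isEmpty {h : EmbRep G} (hV : IsEmpty f.dom.V)
    (hA : Set.range f.map.fA ⊆ Set.range h.map.fA) :
    ∃ g : f.dom ⟶ h.dom, g ≫ h.map = f.map := by
  classical
  obtain ⟨a⟩ : Nonempty f.dom.A := f.conn.1.resolve_right (not_nonempty_iff.2 hV)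
  obtain ⟨b, hb⟩ := hA ⟨a, rfl⟩
  have hD : IsEmpty f.dom.D := ⟨fun d => hV.false (f.dom.t d)⟩
  refine ⟨{ fA := fun c => if c = a then b else h.dom.inv b
            fD := fun d => hD.elim d, fV := fun v => hV.elim v
            comm_inv := fun c => ?_, comm_incl := fun d => hD.elim d
            comm_t := fun d => hD.elim d, pullback := fun v => hV.elim v },
    Etale.ext (funext fun c => ?_) (funext fun d => hD.elim d) (funext fun v => hV.elim v)⟩
  · rcases f.conn.eq_or_eq_inv hV a c with rfl | rfl
    · rw [if_neg (f.dom.inv_ne c), if_pos rfl]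
    · rw [f.dom.inv_inv, if_pos rfl, if_neg (f.dom.inv_ne a), h.dom.inv_inv]
  · change h.map.fA (if c = a then b else h.dom.inv b) = f.map.fA c
    rcases f.conn.eq_or_eq_inv hV a c with rfl | rfl
    · rw [if_pos rfl, hb]
    · rw [if_neg (f.dom.inv_ne a), h.map.comm_inv, f.map.comm_inv, hb]

/-- Factorization in terms of the images of vertices and boundaries. -/
theorem mem_bdry_of_factor {h : EmbRep G} (g : f.dom ⟶ h.dom) (hg : g ≫ h.map = f.map) {a : G.A}
    (ha : a ∈ h.bdry) (hW : G.inv a ∈ G.att (Set.range f.map.fV)) : a ∈ f.bdry := by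
  have hA : ∀ a, h.map.fA (g.fA a) = f.map.fA a := fun a => congrFun (congrArg Etale.fA hg) a
  obtain ⟨b, hb, rfl⟩ := ha
  obtain ⟨d, hd⟩ := f.exists_incl hW
  have hV : Nonempty h.dom.V := ⟨g.fV (f.dom.t d)⟩
  obtain ⟨e, he⟩ := (h.conn.incl_or hV b).resolve_left hb
  have h1 : e = g.fD d := h.eq_of_fA_incl (by
    rw [he, h.map.comm_inv, ← g.comm_incl, hA, hd])
  have h2 : b = g.fA (f.dom.inv (f.dom.incl d)) := by
    rw [g.comm_inv, g.comm_incl, ← h1, he, h.dom.inv_inv]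
  refine ⟨f.dom.inv (f.dom.incl d), ?_, by rw [h2, hA]⟩
  rintro ⟨d', hd'⟩
  exact hb ⟨g.fD d', by rw [h2, ← hd', g.comm_incl]⟩

end EmbRep

/-! ### The order on embeddings in terms of vertices, arcs and boundary -/

namespace Emb

variable {G : Graph.{u}}

theorem exists_rep (e : Emb G) : ∃ f, mk f = e := Quotient.exists_rep e

theorem nonempty_verts_mk {f : EmbRep G} : (mk f).verts.Nonempty ↔ Nonempty f.dom.V :=
  Set.range_nonempty_iff_nonempty

theorem verts_mk_eq_empty {f : EmbRep G} : (mk f).verts = ∅ ↔ IsEmpty f.dom.V :=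
  Set.range_eq_empty_iff

theorem isEmbData {e : Emb G} (h : e.verts.Nonempty) : G.IsEmbData e.verts e.bdry := by
  obtain ⟨f, rfl⟩ := e.exists_rep
  exact f.isEmbData (nonempty_verts_mk.1 h)

theorem mem_arcs {e : Emb G} (h : e.verts.Nonempty) {a : G.A} :
    a ∈ e.arcs ↔ a ∈ G.att e.verts ∨ G.inv a ∈ G.att e.verts := by
  obtain ⟨f, rfl⟩ := e.exists_rep
  exact f.range_fA (nonempty_verts_mk.1 h) a

theorem exists_edge {e : Emb G} (h : e.verts = ∅) :
    ∃ a, e.bdry = {a, G.inv a} ∧ e.arcs = {a, G.inv a} := by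
  obtain ⟨f, rfl⟩ := e.exists_rep
  exact f.exists_edge (verts_mk_eq_empty.1 h)

theorem bdry_eq_of_mem {e : Emb G} (h : e.verts = ∅) {a : G.A} (ha : a ∈ e.bdry) :
    e.bdry = {a, G.inv a} := by
  obtain ⟨b, hb, -⟩ := exists_edge h
  rw [hb] at ha ⊢
  rcases ha with rfl | rfl
  · rfl
  · rw [G.inv_inv, Set.pair_comm]

theorem arcs_eq_bdry {e : Emb G} (h : e.verts = ∅) : e.arcs = e.bdry := by
  obtain ⟨b, hb, hb'⟩ := exists_edge h
  rw [hb, hb']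

theorem bdry_subset_arcs (e : Emb G) : e.bdry ⊆ e.arcs := by
  obtain ⟨f, rfl⟩ := e.exists_rep
  rintro _ ⟨a, -, rfl⟩
  exact ⟨a, rfl⟩

theorem inv_mem_arcs {e : Emb G} {a : G.A} (h : a ∈ e.arcs) : G.inv a ∈ e.arcs := by
  obtain ⟨f, rfl⟩ := e.exists_rep
  obtain ⟨b, rfl⟩ := h
  exact ⟨_, f.map.comm_inv b⟩

theorem mk_le_mk {f h : EmbRep G} :
    (mk f).le (mk h) ↔ ∃ g : f.dom ⟶ h.dom, g ≫ h.map = f.map := by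
  constructor
  · rintro ⟨f', h', hf, hh, g, hg⟩
    obtain ⟨z, hz⟩ := Quotient.exact hf
    obtain ⟨w, hw⟩ := Quotient.exact hh
    exact ⟨z.inv ≫ g ≫ w.hom, by rw [Category.assoc, Category.assoc, hw, hg, ← hz]; simp⟩
  · rintro ⟨g, hg⟩
    exact ⟨f, h, rfl, rfl, g, hg⟩

theorem le_refl (e : Emb G) : e.le e := by
  obtain ⟨f, rfl⟩ := e.exists_rep
  exact mk_le_mk.2 ⟨𝟙 _, Category.id_comp _⟩

theorem le_trans {e e' e'' : Emb G} (h : e.le e') (h' : e'.le e'') : e.le e'' := by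
  obtain ⟨f, rfl⟩ := e.exists_rep
  obtain ⟨f', rfl⟩ := e'.exists_rep
  obtain ⟨f'', rfl⟩ := e''.exists_rep
  obtain ⟨g, hg⟩ := mk_le_mk.1 h
  obtain ⟨g', hg'⟩ := mk_le_mk.1 h'
  exact mk_le_mk.2 ⟨g ≫ g', by rw [Category.assoc, hg', hg]⟩

theorem le_antisymm {e e' : Emb G} (h : e.le e') (h' : e'.le e) : e = e' := by
  obtain ⟨f, rfl⟩ := e.exists_rep
  obtain ⟨f', rfl⟩ := e'.exists_rep
  obtain ⟨g, hg⟩ := mk_le_mk.1 h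
  obtain ⟨g', hg'⟩ := mk_le_mk.1 h'
  exact Quotient.sound ⟨⟨g, g', f.eq_id _ (by rw [Category.assoc, hg', hg]),
    f'.eq_id _ (by rw [Category.assoc, hg, hg'])⟩, hg⟩

theorem le_of_nonempty {e e' : Emb G} (hn : e.verts.Nonempty) (hW : e.verts ⊆ e'.verts)
    (hB : ∀ a ∈ e'.bdry, G.inv a ∈ G.att e.verts → a ∈ e.bdry) : e.le e' := by
  obtain ⟨f, rfl⟩ := e.exists_rep
  obtain ⟨f', rfl⟩ := e'.exists_rep
  exact mk_le_mk.2 (f.exists_factor (nonempty_verts_mk.1 hn) hW hB)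

theorem le_of_empty {e e' : Emb G} (he : e.verts = ∅) (hA : e.bdry ⊆ e'.arcs) : e.le e' := by
  rw [← arcs_eq_bdry he] at hA
  obtain ⟨f, rfl⟩ := e.exists_rep
  obtain ⟨f', rfl⟩ := e'.exists_rep
  exact mk_le_mk.2 (f.exists_factor_of_isEmpty (verts_mk_eq_empty.1 he) hA)

theorem le_of_empty_of_mem {e e' : Emb G} (he : e.verts = ∅) {a : G.A} (ha : a ∈ e.bdry)
    (ha' : a ∈ e'.arcs) : e.le e' := by
  refine le_of_empty he ?_
  rw [bdry_eq_of_mem he ha]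
  rintro _ (rfl | rfl)
  · exact ha'
  · exact inv_mem_arcs ha'

theorem verts_subset_of_le {e e' : Emb G} (h : e.le e') : e.verts ⊆ e'.verts := by
  obtain ⟨f, rfl⟩ := e.exists_rep
  obtain ⟨f', rfl⟩ := e'.exists_rep
  obtain ⟨g, hg⟩ := mk_le_mk.1 h
  rintro _ ⟨v, rfl⟩
  exact ⟨g.fV v, congrFun (congrArg Etale.fV hg) v⟩

theorem arcs_subset_of_le {e e' : Emb G} (h : e.le e') : e.arcs ⊆ e'.arcs := by
  obtain ⟨f, rfl⟩ := e.exists_rep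
  obtain ⟨f', rfl⟩ := e'.exists_rep
  obtain ⟨g, hg⟩ := mk_le_mk.1 h
  rintro _ ⟨v, rfl⟩
  exact ⟨g.fA v, congrFun (congrArg Etale.fA hg) v⟩

theorem mem_bdry_of_le {e e' : Emb G} (h : e.le e') {a : G.A} (ha : a ∈ e'.bdry)
    (ha' : G.inv a ∈ G.att e.verts) : a ∈ e.bdry := by
  obtain ⟨f, rfl⟩ := e.exists_rep
  obtain ⟨f', rfl⟩ := e'.exists_rep
  obtain ⟨g, hg⟩ := mk_le_mk.1 h
  exact f.mem_bdry_of_factor g hg ha ha'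

/-- An embedding is determined by its vertices and its boundary. -/
theorem ext_verts_bdry {e e' : Emb G} (hV : e.verts = e'.verts) (hB : e.bdry = e'.bdry) :
    e = e' := by
  rcases e.verts.eq_empty_or_nonempty with h | h
  · refine le_antisymm (le_of_empty h ?_) (le_of_empty (hV ▸ h) ?_)
    · rw [hB]
      exact e'.bdry_subset_arcs
    · rw [← hB]
      exact e.bdry_subset_arcs
  · exact le_antisymm (le_of_nonempty h hV.le fun a ha _ => hB ▸ ha)
      (le_of_nonempty (hV ▸ h) hV.ge fun a ha _ => hB ▸ ha)

@[simp] theorem verts_top (hG : G.Connected) : (top G hG).verts = Set.univ :=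
  Set.range_id

@[simp] theorem bdry_top (hG : G.Connected) : (top G hG).bdry = G.boundary :=
  Set.image_id _

theorem le_top (hG : G.Connected) (e : Emb G) : e.le (top G hG) := by
  obtain ⟨f, rfl⟩ := e.exists_rep
  exact mk_le_mk.2 ⟨f.map, Category.comp_id _⟩

end Emb

/-! ### Realizing the data (W, B) by an embedding -/

namespace Graph

variable {G : Graph.{u}}

/-- The graph with vertices `W` and boundary `B`. An arc `(a, false)` is a half-edge and `(a, true)`
is a boundary arc. -/
noncomputable def IsEmbData.graph {W : Set G.V} {B : Set G.A} (h : G.IsEmbData W B) : Graph.{u} :=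
  open Classical in
  { A := {p : G.A × Bool // (p.2 = false → p.1 ∈ G.att W) ∧ (p.2 = true → p.1 ∈ B)}
    D := {d : G.D // G.t d ∈ W}
    V := W
    finA := have := G.finA; inferInstance
    finD := have := G.finD; inferInstance
    finV := have := G.finV; inferInstance
    -- The opposite of a boundary arc is always a half-edge. The opposite of a half-edge is a
    -- boundary arc exactly when `B` prescribes it, even if a half-edge with the same arc of `G`
    -- exists: this is how an edge is cut.
    inv := fun p => ⟨(G.inv p.1.1, !p.1.2 && decide (G.inv p.1.1 ∈ B)), by
      obtain ⟨⟨a, b⟩, h1, h2⟩ := p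
      cases b
      · have h1 := h1 rfl
        by_cases hB : G.inv a ∈ B
        · simp [hB]
        · simpa [hB] using (h.inner a h1 hB).1
      · simpa using h.inv_mem a (h2 rfl)⟩
    inv_inv := by
      rintro ⟨⟨a, b⟩, h1, h2⟩
      refine Subtype.ext (Prod.ext (G.inv_inv a) ?_)
      cases b
      · have h1 := h1 rfl
        by_cases hB : G.inv a ∈ B
        · simp [hB]
        · simpa [hB, G.inv_inv] using (h.inner a h1 hB).2
      · simpa [G.inv_inv] using h2 rfl
    inv_ne := fun p hp => G.inv_ne p.1.1 (congrArg (fun q => q.1.1) hp)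
    incl := fun d => ⟨(G.incl d.1, false), fun _ => ⟨d.1, rfl, d.2⟩, fun h => by simp at h⟩
    incl_inj := fun d d' hd => Subtype.ext (G.incl_inj (congrArg (fun q => q.1.1) hd))
    t := fun d => ⟨G.t d.1, d.2⟩ }

theorem IsEmbData.graph_connected {W : Set G.V} {B : Set G.A} (h : G.IsEmbData W B) :
    h.graph.Connected := by
  classical
  refine ⟨Or.inr h.nonempty.to_subtype, fun S T hS hT => ?_⟩
  have hfalse : ∀ p : h.graph.A, p.1.2 = false → ∃ d, h.graph.incl d = p := by
    rintro ⟨⟨a, b⟩, h1, h2⟩ hb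
    obtain ⟨d, hd, hd'⟩ := h1 hb
    exact ⟨⟨d, hd'⟩, Subtype.ext (Prod.ext hd hb.symm)⟩
  have hor : ∀ p : h.graph.A,
      (∃ d, h.graph.incl d = p) ∨ ∃ d, h.graph.incl d = h.graph.inv p := by
    intro p
    by_cases hb : p.1.2 = false
    · exact Or.inl (hfalse p hb)
    · refine Or.inr (hfalse _ ?_)
      change (!p.1.2 && decide _) = false
      simp [hb]
  by_cases hTn : T.Nonempty
  · have hTW : Subtype.val '' T = W := by
      refine h.conn _ (by rintro _ ⟨v, -, rfl⟩; exact v.2) (hTn.image _) ?_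
      rintro d d' ⟨v, hv, hvd⟩ hd' hdd hB
      have hdW : G.t d ∈ W := hvd ▸ v.2
      have hv' : v = h.graph.t ⟨d, hdW⟩ := Subtype.ext hvd
      have hi : h.graph.inv (h.graph.incl ⟨d, hdW⟩) = h.graph.incl ⟨d', hd'⟩ := by
        refine Subtype.ext (Prod.ext hdd.symm ?_)
        change (!false && decide (G.inv (G.incl d) ∈ B)) = false
        rw [← hdd]
        have := (h.inner (G.incl d') ⟨d', rfl, hd'⟩ (by rwa [hdd, G.inv_inv])).2
        simpa using this
      refine ⟨⟨G.t d', hd'⟩, (hT ⟨d', hd'⟩).1 ?_, rfl⟩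
      have h1 : h.graph.inv (h.graph.incl ⟨d, hdW⟩) ∈ S := (hS _).2 ((hT ⟨d, hdW⟩).2 (hv' ▸ hv))
      rwa [hi] at h1
    have hTu : T = Set.univ := by
      refine Set.eq_univ_of_forall fun v => ?_
      have : v.1 ∈ Subtype.val '' T := by
        rw [hTW]
        exact v.2
      obtain ⟨w, hw, hwv⟩ := this
      rwa [← Subtype.ext hwv]
    refine Or.inr ⟨Set.eq_univ_of_forall fun p => ?_, hTu⟩
    rcases hor p with ⟨d, hd⟩ | ⟨d, hd⟩
    · rw [← hd, hT, hTu]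
      trivial
    · rw [← hS, ← hd, hT, hTu]
      trivial
  · rw [Set.not_nonempty_iff_eq_empty] at hTn
    refine Or.inl ⟨Set.eq_empty_of_forall_notMem fun p hp => ?_, hTn⟩
    rcases hor p with ⟨d, hd⟩ | ⟨d, hd⟩
    · rw [← hd, hT, hTn] at hp
      exact hp
    · rw [← hS, ← hd, hT, hTn] at hp
      exact hp

/-- The embedding with vertices `W` and boundary `B`. -/
noncomputable def IsEmbData.rep {W : Set G.V} {B : Set G.A} (h : G.IsEmbData W B) : EmbRep G where
  dom := h.graph
  conn := h.graph_connected
  map :=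
    { fA := fun p => p.1.1, fD := fun d => d.1, fV := fun v => v.1
      comm_inv := fun _ => rfl
      comm_incl := fun _ => rfl
      comm_t := fun _ => rfl
      pullback := fun v d' hd => ⟨⟨d', hd ▸ v.2⟩, ⟨Subtype.ext hd, rfl⟩,
        fun _ hy => Subtype.ext hy.2⟩ }
  inj := Subtype.val_injective

theorem IsEmbData.exists_emb {W : Set G.V} {B : Set G.A} (h : G.IsEmbData W B) :
    ∃ e : Emb G, e.verts = W ∧ e.bdry = B := by
  refine ⟨Emb.mk h.rep, Subtype.range_val, ?_⟩
  ext a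
  constructor
  · rintro ⟨⟨⟨a, b⟩, h1, h2⟩, hp, rfl⟩
    cases b
    · obtain ⟨d, hd, hd'⟩ := h1 rfl
      exact (hp ⟨⟨d, hd'⟩, Subtype.ext (Prod.ext hd rfl)⟩).elim
    · exact h2 rfl
  · intro ha
    refine ⟨⟨(a, true), fun h => by simp at h, fun _ => ha⟩, ?_, rfl⟩
    rintro ⟨d, hd⟩
    exact Bool.false_ne_true (congrArg (fun q => q.1.2) hd)

/-- The graph with no vertex and the two arcs `a` and `inv a`. -/
def edgeGraph (G : Graph.{u}) (a : G.A) : Graph.{u} where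
  A := {b : G.A // b = a ∨ b = G.inv a}
  D := PEmpty
  V := PEmpty
  finA := have := G.finA; inferInstance
  finD := inferInstance
  finV := inferInstance
  inv b := ⟨G.inv b.1, by
    rcases b.2 with h | h
    · exact Or.inr (by rw [h])
    · exact Or.inl (by rw [h, G.inv_inv])⟩
  inv_inv b := Subtype.ext (G.inv_inv _)
  inv_ne b hb := G.inv_ne _ (congrArg Subtype.val hb)
  incl d := d.elim
  incl_inj d := d.elim
  t d := d.elim

theorem exists_emb_edge (a : G.A) : ∃ e : Emb G, e.verts = ∅ ∧ e.bdry = {a, G.inv a} := by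
  have hc : (G.edgeGraph a).Connected := by
    refine ⟨Or.inl ⟨⟨a, Or.inl rfl⟩⟩, fun S T hS _ => ?_⟩
    have hT : ∀ T : Set (G.edgeGraph a).V, T = ∅ := fun T =>
      Set.eq_empty_of_forall_notMem fun v _ => PEmpty.elim v
    by_cases h : (⟨a, Or.inl rfl⟩ : (G.edgeGraph a).A) ∈ S
    · refine Or.inr ⟨Set.eq_univ_of_forall ?_, (hT _).trans (hT _).symm⟩
      rintro ⟨b, rfl | rfl⟩
      · exact h
      · exact (hS ⟨a, Or.inl rfl⟩).2 h
    · refine Or.inl ⟨Set.eq_empty_of_forall_notMem ?_, hT _⟩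
      rintro ⟨b, rfl | rfl⟩ hb
      · exact h hb
      · exact h ((hS ⟨a, Or.inl rfl⟩).1 hb)
  refine ⟨Emb.mk ⟨G.edgeGraph a, hc,
    { fA := fun b => b.1, fD := fun d => d.elim, fV := fun d => d.elim
      comm_inv := fun _ => rfl, comm_incl := fun d => d.elim, comm_t := fun d => d.elim
      pullback := fun v => v.elim }, fun v => v.elim⟩, ?_, ?_⟩
  · exact Set.eq_empty_of_forall_notMem fun v ⟨w, _⟩ => w.elim
  · ext b
    constructor
    · rintro ⟨b, -, rfl⟩
      exact b.2
    · intro hb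
      exact ⟨⟨b, hb⟩, fun ⟨d, _⟩ => d.elim, rfl⟩

end Graph

/-! ### Stars, gluing, and attaching along an edge -/

namespace Graph

variable {G : Graph.{u}}

/-- All edges at `v` are cut, loops included, so `inner` is vacuous. -/
theorem IsEmbData.star (v : G.V) : G.IsEmbData {v} {a | G.inv a ∈ G.att {v}} where
  nonempty := Set.singleton_nonempty v
  inv_mem _ ha := ha
  inner a ha hB := (hB (show G.inv (G.inv a) ∈ G.att {v} by rwa [G.inv_inv])).elim
  conn T hT hn _ := (Set.subset_singleton_iff_eq.1 hT).resolve_left hn.ne_empty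

/-- Gluing two boundary arcs of an embedding. -/
theorem IsEmbData.glue {W : Set G.V} {B : Set G.A} (h : G.IsEmbData W B) {a : G.A} (ha : a ∈ B)
    (ha' : G.inv a ∈ B) : G.IsEmbData W (B \ {a, G.inv a}) where
  nonempty := h.nonempty
  inv_mem x hx := h.inv_mem x hx.1
  inner x hx hB := by
    by_cases hxB : G.inv x ∈ B
    · have : G.inv x = a ∨ G.inv x = G.inv a := by
        by_contra hc
        exact hB ⟨hxB, hc⟩
      rcases this with h1 | h1
      · refine ⟨?_, fun h2 => h2.2 (Or.inr (inv_eq_iff.1 h1))⟩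
        rw [h1, ← G.inv_inv a]
        exact h.inv_mem _ ha'
      · refine ⟨?_, fun h2 => h2.2 (Or.inl ?_)⟩
        · rw [h1]
          exact h.inv_mem _ ha
        · rw [← G.inv_inv x, h1, G.inv_inv]
    · exact ⟨(h.inner x hx hxB).1, fun h2 => (h.inner x hx hxB).2 h2.1⟩
  conn T hT hn hcl := h.conn T hT hn fun d d' h1 h2 h3 h4 => hcl d d' h1 h2 h3 fun h5 => h4 h5.1

/-- Gluing two vertex disjoint embeddings along an edge. -/
theorem IsEmbData.union {W₁ W₂ : Set G.V} {B₁ B₂ : Set G.A} (h₁ : G.IsEmbData W₁ B₁)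
    (h₂ : G.IsEmbData W₂ B₂) (hd : W₁ ∩ W₂ = ∅) {a : G.A} (ha : a ∈ B₁) (ha' : G.inv a ∈ B₂) :
    G.IsEmbData (W₁ ∪ W₂) ((B₁ ∪ B₂) \ {a, G.inv a}) := by
  have hno : ∀ {x}, x ∈ G.att W₁ → x ∈ G.att W₂ → False := fun h h' =>
    not_mem_att_empty (hd ▸ att_inter h h')
  have hinv : ∀ x ∈ B₁ ∪ B₂, G.inv x ∈ G.att (W₁ ∪ W₂) := fun x hx =>
    att_union.2 (hx.imp (h₁.inv_mem x) (h₂.inv_mem x))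
  have haW₂ : a ∈ G.att W₂ := by simpa [G.inv_inv] using h₂.inv_mem _ ha'
  have haW₁ : G.inv a ∈ G.att W₁ := h₁.inv_mem _ ha
  refine ⟨h₁.nonempty.inl, fun x hx => hinv x hx.1, fun x hx hB => ?_, fun T hT hn hcl => ?_⟩
  · by_cases hxB : G.inv x ∈ B₁ ∪ B₂
    · have : G.inv x = a ∨ G.inv x = G.inv a := by
        by_contra hc
        exact hB ⟨hxB, hc⟩
      rcases this with h1 | h1
      · exact ⟨by rw [h1]; exact att_union.2 (Or.inr haW₂),
          fun h2 => h2.2 (Or.inr (inv_eq_iff.1 h1))⟩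
      · exact ⟨by rw [h1]; exact att_union.2 (Or.inl haW₁),
          fun h2 => h2.2 (Or.inl (by rw [← G.inv_inv x, h1, G.inv_inv]))⟩
    · rcases att_union.1 hx with h | h
      · obtain ⟨h3, h4⟩ := h₁.inner x h fun h => hxB (Or.inl h)
        exact ⟨att_union.2 (Or.inl h3), fun h5 => h5.1.elim h4 fun h6 => hno h3 (h₂.inv_mem x h6)⟩
      · obtain ⟨h3, h4⟩ := h₂.inner x h fun h => hxB (Or.inr h)
        exact ⟨att_union.2 (Or.inr h3), fun h5 => h5.1.elim (fun h6 => hno (h₁.inv_mem x h6) h3) h4⟩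
  · have e₁ : (T ∩ W₁).Nonempty → T ∩ W₁ = W₁ := fun hn₁ =>
      h₁.conn _ Set.inter_subset_right hn₁ fun d d' h1 h2 h3 h4 =>
        ⟨hcl d d' h1.1 (Or.inl h2) h3 fun h5 => h5.1.elim h4 fun h6 =>
          hno ⟨d', rfl, h2⟩ (h3 ▸ h₂.inv_mem _ h6), h2⟩
    have e₂ : (T ∩ W₂).Nonempty → T ∩ W₂ = W₂ := fun hn₂ =>
      h₂.conn _ Set.inter_subset_right hn₂ fun d d' h1 h2 h3 h4 =>
        ⟨hcl d d' h1.1 (Or.inr h2) h3 fun h5 => h5.1.elim (fun h6 =>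
          hno (h3 ▸ h₁.inv_mem _ h6) ⟨d', rfl, h2⟩) h4, h2⟩
    obtain ⟨d₂, hd₂, hd₂'⟩ := haW₂
    obtain ⟨d₁, hd₁, hd₁'⟩ := haW₁
    -- The glued edge, removed from the boundary, carries `T` across.
    have c₁ : (T ∩ W₁).Nonempty → (T ∩ W₂).Nonempty := fun hn₁ => by
      refine ⟨G.t d₂, hcl d₁ d₂ ?_ (Or.inr hd₂') (by rw [hd₁, hd₂, G.inv_inv])
        (fun h => h.2 (Or.inr hd₁)), hd₂'⟩
      rw [← e₁ hn₁] at hd₁'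
      exact hd₁'.1
    have c₂ : (T ∩ W₂).Nonempty → (T ∩ W₁).Nonempty := fun hn₂ => by
      refine ⟨G.t d₁, hcl d₂ d₁ ?_ (Or.inl hd₁') (by rw [hd₁, hd₂])
        (fun h => h.2 (Or.inl hd₂)), hd₁'⟩
      rw [← e₂ hn₂] at hd₂'
      exact hd₂'.1
    have hboth : (T ∩ W₁).Nonempty ∧ (T ∩ W₂).Nonempty := by
      obtain ⟨x, hx⟩ := hn
      rcases hT hx with h | h
      · exact ⟨⟨x, hx, h⟩, c₁ ⟨x, hx, h⟩⟩
      · exact ⟨c₂ ⟨x, hx, h⟩, ⟨x, hx, h⟩⟩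
    rw [← e₁ hboth.1, ← e₂ hboth.2, ← Set.inter_union_distrib_left, Set.inter_eq_left.2 hT]

end Graph

/-! ### Building embeddings from stars -/

namespace Emb

variable {G : Graph.{u}}

/-- The embedding of the star of a vertex. -/
noncomputable def star (v : G.V) : Emb G := (IsEmbData.star v).exists_emb.choose

@[simp] theorem verts_star (v : G.V) : (star v).verts = {v} :=
  (IsEmbData.star v).exists_emb.choose_spec.1

theorem mem_bdry_star {v : G.V} {a : G.A} : a ∈ (star v).bdry ↔ G.inv a ∈ G.att {v} := by
  rw [star, (IsEmbData.star v).exists_emb.choose_spec.2]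
  rfl

theorem inv_incl_mem_bdry_star (d : G.D) : G.inv (G.incl d) ∈ (star (G.t d)).bdry :=
  mem_bdry_star.2 (by rw [G.inv_inv]; exact ⟨d, rfl, rfl⟩)

theorem star_le {e : Emb G} {v : G.V} (hv : v ∈ e.verts) : (star v).le e := by
  refine le_of_nonempty (by simp) (by simpa) fun a _ ha' => ?_
  rw [verts_star] at ha'
  exact mem_bdry_star.2 ha'

theorem disjoint_star_of_notMem {e : Emb G} {v : G.V} (hv : v ∉ e.verts) :
    e.verts ∩ (star v).verts = ∅ := by
  rw [verts_star]
  exact Set.inter_singleton_eq_empty.2 hv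

theorem bdry_subset_of_le_of_verts_eq {k l : Emb G} (h : k.le l) (hn : l.verts.Nonempty)
    (hV : k.verts = l.verts) : l.bdry ⊆ k.bdry := fun a ha =>
  mem_bdry_of_le h ha (hV ▸ (isEmbData hn).inv_mem a ha)

/-- Every embedding is obtained from a smaller one by successively attaching stars of vertices along
an edge and gluing pairs of boundary arcs. -/
theorem induction_of_le {P : Emb G → Prop} {h l : Emb G} (hn : h.verts.Nonempty) (hl : h.le l)
    (attach : ∀ (k k' : Emb G) (v : G.V) (a : G.A), k.verts.Nonempty → k.le k' → (star v).le k' →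
      v ∉ k.verts → a ∈ k.bdry → G.inv a ∈ (star v).bdry → k'.verts = k.verts ∪ {v} →
      k'.bdry = (k.bdry ∪ (star v).bdry) \ {a, G.inv a} → P k → P k')
    (glue : ∀ (k k' : Emb G) (a : G.A), k.verts.Nonempty → k.le k' → a ∈ k.bdry →
      G.inv a ∈ k.bdry → k'.verts = k.verts → k'.bdry = k.bdry \ {a, G.inv a} → P k → P k')
    (hP : P h) : P l := by
  have := G.finA
  have := G.finV
  have hln : l.verts.Nonempty := hn.mono (verts_subset_of_le hl)
  have dl := isEmbData hln
  obtain ⟨k, hkn, hkl, hkV, hkP⟩ :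
      ∃ k : Emb G, k.verts.Nonempty ∧ k.le l ∧ k.verts = l.verts ∧ P k := by
    suffices ∀ n (k : Emb G), (l.verts \ k.verts).ncard = n → k.verts.Nonempty → k.le l → P k →
        ∃ k : Emb G, k.verts.Nonempty ∧ k.le l ∧ k.verts = l.verts ∧ P k from
      this _ h rfl hn hl hP
    -- Induction on the number of missing vertices: connectedness of `l` gives an edge, uncut in
    -- `l`, to a missing vertex, whose star is attached along this edge.
    intro n
    induction n using Nat.strong_induction_on with
    | _ n ih =>
      intro k hk hkn hkl hkP
      by_cases hV : k.verts = l.verts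
      · exact ⟨k, hkn, hkl, hV, hkP⟩
      obtain ⟨d, d', hd, hd', hdk, hi, hB⟩ := dl.exists_step (verts_subset_of_le hkl) hkn hV
      have hB' : G.incl d' ∉ l.bdry := (dl.inner _ ⟨d', rfl, hd'⟩ (by rwa [hi, G.inv_inv])).2
      have hdk' : G.incl d' ∈ k.bdry := by
        by_contra hc
        rw [hi] at hc
        have := ((isEmbData hkn).inner _ ⟨d, rfl, hd⟩ hc).1
        rw [← hi] at this
        exact hdk (incl_mem_att.1 this)
      have hds : G.inv (G.incl d') ∈ (star (G.t d')).bdry := inv_incl_mem_bdry_star d'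
      have hdis := disjoint_star_of_notMem hdk
      obtain ⟨k', hk'V, hk'B⟩ := ((isEmbData hkn).union (isEmbData (by simp)) hdis hdk'
        hds).exists_emb
      rw [verts_star] at hk'V
      have hno : ∀ {x}, x ∈ G.att k.verts → x ∈ G.att {G.t d'} → False := fun h h' => by
        rw [verts_star] at hdis
        exact not_mem_att_empty (hdis ▸ att_inter h h')
      have hk'l : k'.le l := by
        refine le_of_nonempty (hk'V ▸ hkn.inl) ?_ fun a ha ha' => ?_
        · rw [hk'V]
          exact Set.union_subset (verts_subset_of_le hkl) (by simpa)
        · rw [hk'B]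
          rw [hk'V, att_union] at ha'
          refine ⟨ha'.imp (fun h => mem_bdry_of_le hkl ha h) (fun h => mem_bdry_star.2 h), ?_⟩
          rintro (rfl | rfl)
          · exact hB' ha
          · rw [hi, G.inv_inv] at ha
            exact hB ha
      refine ih _ ?_ k' rfl (hk'V ▸ hkn.inl) hk'l (attach k k' _ _ hkn ?_
        (star_le (by simp [hk'V])) hdk hdk' hds hk'V hk'B hkP)
      · rw [← hk]
        refine Set.ncard_lt_ncard ⟨Set.sdiff_subset_sdiff_right (by simp [hk'V]), fun hs => ?_⟩
        exact (hs ⟨hd', hdk⟩).2 (by simp [hk'V])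
      · refine le_of_nonempty hkn (by simp [hk'V]) fun a ha ha' => ?_
        rw [hk'B] at ha
        exact ha.1.resolve_right fun h => hno ha' (mem_bdry_star.1 h)
  -- With all vertices present, `k` differs from `l` only by cutting more edges. The surplus
  -- boundary arcs come in opposite pairs, and gluing one pair shrinks the boundary.
  suffices ∀ n (k : Emb G), k.bdry.ncard = n → k.le l → k.verts = l.verts → P k → P l from
    this _ k rfl hkl hkV hkP
  intro n
  induction n using Nat.strong_induction_on with
  | _ n ih =>
    intro k hk hkl hkV hkP
    have hsub := bdry_subset_of_le_of_verts_eq hkl hln hkV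
    have hkn := hkV ▸ hln
    by_cases hB : k.bdry = l.bdry
    · exact ext_verts_bdry hkV hB ▸ hkP
    obtain ⟨a, ha, hal⟩ := Set.not_subset.1 fun h => hB (h.antisymm hsub)
    have h1 := dl.inner (G.inv a) (hkV ▸ (isEmbData hkn).inv_mem a ha) (by rwa [G.inv_inv])
    rw [G.inv_inv, ← hkV] at h1
    have ha' : G.inv a ∈ k.bdry := by
      by_contra hc
      exact ((isEmbData hkn).inner a h1.1 hc).2 ha
    obtain ⟨k', hk'V, hk'B⟩ := ((isEmbData hkn).glue ha ha').exists_emb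
    refine ih _ ?_ k' rfl ?_ (hk'V.trans hkV) (glue k k' a hkn ?_ ha ha' hk'V hk'B hkP)
    · rw [← hk, hk'B]
      exact Set.ncard_lt_ncard ⟨Set.sdiff_subset, fun hs => (hs ha).2 (Or.inl rfl)⟩
    · refine le_of_nonempty (hk'V ▸ hkn) (hk'V.trans hkV).le fun x hx _ => ?_
      rw [hk'B]
      refine ⟨hsub hx, ?_⟩
      rintro (rfl | rfl)
      · exact hal hx
      · exact h1.2 hx
    · refine le_of_nonempty hkn hk'V.ge fun x hx _ => ?_
      rw [hk'B] at hx
      exact hx.1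

end Emb

/-! ### Directed paths, acyclicity and convex inclusions -/

namespace DiGraph

variable {G H : DiGraph.{u}}

/-- There is an edge from `v` to `w`. -/
def Adj (G : DiGraph.{u}) (v w : G.V) : Prop := ∃ o i, G.tO o = v ∧ G.tI i = w ∧ G.sO o = G.sI i

/-- `e` is an input and `f` is an output of the same vertex. -/
def Step (G : DiGraph.{u}) (e f : G.E) : Prop := ∃ i o, G.sI i = e ∧ G.sO o = f ∧ G.tI i = G.tO o

/-- The linear graph with `n` vertices. -/
def line (n : ℕ) : DiGraph.{u} where
  E := ULift (Fin (n + 1))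
  I := ULift (Fin n)
  O := ULift (Fin n)
  V := ULift (Fin n)
  finE := inferInstance
  finI := inferInstance
  finO := inferInstance
  finV := inferInstance
  sI i := ⟨i.down.castSucc⟩
  sI_inj _ _ h := ULift.ext _ _ (Fin.castSucc_injective n (congrArg ULift.down h))
  sO i := ⟨i.down.succ⟩
  sO_inj _ _ h := ULift.ext _ _ (Fin.succ_injective n (congrArg ULift.down h))
  tI := id
  tO := id

theorem line_input_iff {n : ℕ} (e : (line.{u} n).E) : e ∈ (line n).inputs ↔ e = ⟨0⟩ := by
  obtain ⟨e⟩ := e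
  constructor
  · intro h
    refine ULift.ext _ _ ?_
    by_contra hc
    obtain ⟨k, hk⟩ := Fin.exists_succ_eq.2 hc
    exact h ⟨⟨k⟩, ULift.ext _ _ hk⟩
  · rintro h ⟨k, hk⟩
    exact Fin.succ_ne_zero k.down (congrArg ULift.down (hk.trans h))

theorem line_output_iff {n : ℕ} (e : (line.{u} n).E) :
    e ∈ (line n).outputs ↔ e = ⟨Fin.last n⟩ := by
  obtain ⟨e⟩ := e
  constructor
  · intro h
    refine ULift.ext _ _ ?_
    by_contra hc
    obtain ⟨k, hk⟩ := Fin.exists_castSucc_eq.2 hc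
    exact h ⟨⟨k⟩, ULift.ext _ _ hk⟩
  · rintro h ⟨k, hk⟩
    exact Fin.castSucc_ne_last k.down (congrArg ULift.down (hk.trans h))

theorem line_isLinear (n : ℕ) : (line.{u} n).IsLinear where
  conn := by
    refine ⟨Or.inl ⟨⟨0⟩⟩, fun S T hI hO => ?_⟩
    have hE : ∀ k : Fin (n + 1), (⟨k⟩ : (line.{u} n).E) ∈ S ↔ (⟨0⟩ : (line.{u} n).E) ∈ S := by
      intro k
      induction k using Fin.induction with
      | zero => rfl
      | succ k ih => exact ((hO ⟨k⟩).trans (hI ⟨k⟩).symm).trans ih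
    by_cases h0 : (⟨0⟩ : (line.{u} n).E) ∈ S
    · exact Or.inr ⟨Set.eq_univ_of_forall fun k => (hE k.down).2 h0,
        Set.eq_univ_of_forall fun k => (hI k).1 ((hE k.down.castSucc).2 h0)⟩
    · exact Or.inl ⟨Set.eq_empty_of_forall_notMem fun k hk => h0 ((hE k.down).1 hk),
        Set.eq_empty_of_forall_notMem fun k hk =>
          h0 ((hE k.down.castSucc).1 ((hI k).2 hk))⟩
  in_vertex v := ⟨v, rfl, fun _ h => h⟩
  out_vertex v := ⟨v, rfl, fun _ h => h⟩
  input := ⟨⟨0⟩, (line_input_iff _).2 rfl, fun _ h => (line_input_iff _).1 h⟩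
  output := ⟨⟨Fin.last n⟩, (line_output_iff _).2 rfl, fun _ h => (line_output_iff _).1 h⟩

/-- Extending a path at its start. -/
theorem exists_line_hom_cons {n : ℕ} (p : line n ⟶ G) {i : G.I} {o : G.O} (hio : G.tI i = G.tO o)
    (ho : p.fE ⟨0⟩ = G.sO o) : ∃ p' : line (n + 1) ⟶ G, p'.fE ⟨0⟩ = G.sI i ∧
      p'.fE ⟨Fin.last (n + 1)⟩ = p.fE ⟨Fin.last n⟩ ∧ p'.fV ⟨0⟩ = G.tI i := by
  refine ⟨{ fE := fun k => Fin.cons (α := fun _ => G.E) (G.sI i) (fun j => p.fE ⟨j⟩) k.down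
            fI := fun k => Fin.cons (α := fun _ => G.I) i (fun j => p.fI ⟨j⟩) k.down
            fO := fun k => Fin.cons (α := fun _ => G.O) o (fun j => p.fO ⟨j⟩) k.down
            fV := fun k => Fin.cons (α := fun _ => G.V) (G.tI i) (fun j => p.fV ⟨j⟩) k.down
            comm_sI := ?_, comm_sO := ?_, comm_tI := ?_, comm_tO := ?_ }, rfl, rfl, rfl⟩
  · rintro ⟨k⟩
    refine Fin.cases rfl (fun k => ?_) k
    exact p.comm_sI ⟨k⟩
  · rintro ⟨k⟩
    refine Fin.cases ho (fun k => ?_) k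
    exact p.comm_sO ⟨k⟩
  · rintro ⟨k⟩
    refine Fin.cases rfl (fun k => ?_) k
    exact p.comm_tI ⟨k⟩
  · rintro ⟨k⟩
    refine Fin.cases hio (fun k => ?_) k
    exact p.comm_tO ⟨k⟩

theorem exists_line_hom {e f : G.E} (h : Relation.ReflTransGen G.Step e f) :
    ∃ (n : ℕ) (p : line n ⟶ G), p.fE ⟨0⟩ = e ∧ p.fE ⟨Fin.last n⟩ = f := by
  induction h using Relation.ReflTransGen.head_induction_on with
  | refl =>
    exact ⟨0, { fE := fun _ => f, fI := fun k => k.down.elim0, fO := fun k => k.down.elim0,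
                fV := fun k => k.down.elim0, comm_sI := fun k => k.down.elim0,
                comm_sO := fun k => k.down.elim0, comm_tI := fun k => k.down.elim0,
                comm_tO := fun k => k.down.elim0 }, rfl, rfl⟩
  | head h _ ih =>
    obtain ⟨i, o, rfl, rfl, hio⟩ := h
    obtain ⟨n, p, hp, rfl⟩ := ih
    obtain ⟨p', h1, h2, -⟩ := exists_line_hom_cons p hio hp
    exact ⟨n + 1, p', h1, h2⟩

/-- Linear graphs are probed through their end edges, so walks on vertices have to be turned into
walks on edges. -/
theorem exists_steps {u w : G.V} (h : Relation.ReflTransGen G.Adj u w) {i : G.I}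
    (hi : G.tI i = u) : ∃ j, G.tI j = w ∧ Relation.ReflTransGen G.Step (G.sI i) (G.sI j) := by
  induction h with
  | refl => exact ⟨i, hi, .refl⟩
  | tail _ h ih =>
    obtain ⟨j, hj, hij⟩ := ih
    obtain ⟨o, k, ho, hk, hok⟩ := h
    exact ⟨k, hk, hij.tail ⟨j, o, rfl, hok, hj.trans ho.symm⟩⟩

/-- A closed walk from `v` returns through some input edge of `v`; starting at that edge instead
gives a path of edges whose two ends coincide. -/
theorem IsAcyclic.not_transGen (hG : G.IsAcyclic) (v : G.V) : ¬ Relation.TransGen G.Adj v v := by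
  intro h
  obtain ⟨u, ⟨o, i, ho, hi, hoi⟩, huv⟩ := Relation.TransGen.head'_iff.1 h
  obtain ⟨j, hj, hij⟩ := exists_steps huv hi
  obtain ⟨n, p, hp, hp'⟩ := exists_line_hom hij
  obtain ⟨p', h1, h2, -⟩ := exists_line_hom_cons p (hj.trans ho.symm) (hp.trans hoi.symm)
  exact hG.2 _ (line_isLinear (n + 1)) ⟨⟨0⟩⟩ p' ⟨0⟩ ⟨Fin.last _⟩ ((line_input_iff _).2 rfl)
    ((line_output_iff _).2 rfl) (h1.trans (h2.trans hp').symm)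

theorem IsAcyclic.wellFounded (hG : G.IsAcyclic) : WellFounded G.Adj := by
  have := G.finV
  have : Std.Irrefl (Relation.TransGen G.Adj) := ⟨hG.not_transGen⟩
  exact Subrelation.wf (fun h => Relation.TransGen.single h)
    (Finite.wellFounded_of_trans_of_irrefl (Relation.TransGen G.Adj))

theorem IsAcyclic.wellFounded_swap (hG : G.IsAcyclic) :
    WellFounded (Function.swap G.Adj) := by
  have := G.finV
  have : Std.Irrefl (Function.swap (Relation.TransGen G.Adj)) := ⟨hG.not_transGen⟩
  have : IsTrans _ (Function.swap (Relation.TransGen G.Adj)) := ⟨fun _ _ _ h h' => h'.trans h⟩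
  exact Subrelation.wf (r := Function.swap (Relation.TransGen G.Adj))
    (fun h => Relation.TransGen.single h)
    (Finite.wellFounded_of_trans_of_irrefl (Function.swap (Relation.TransGen G.Adj)))

/-- The vertices of a convex inclusion are closed under directed paths. -/
theorem IsConvex.mem_range {h : H ⟶ G} (hc : IsConvex h)
    (hI : ∀ i, G.tI i ∈ Set.range h.fV → i ∈ Set.range h.fI)
    (hO : ∀ o, G.tO o ∈ Set.range h.fV → o ∈ Set.range h.fO) {v u w : G.V}
    (hv : v ∈ Set.range h.fV) (hw : w ∈ Set.range h.fV)
    (hvu : Relation.ReflTransGen G.Adj v u) (huw : Relation.ReflTransGen G.Adj u w) :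
    u ∈ Set.range h.fV := by
  induction hvu with
  | refl => exact hv
  | @tail y u _ hyu ih =>
    obtain ⟨o, i, ho, hi, hoi⟩ := hyu
    obtain ⟨o', rfl⟩ := hO o (ho ▸ ih (.head ⟨o, i, ho, hi, hoi⟩ huw))
    obtain ⟨j, hj, hij⟩ := exists_steps huw hi
    obtain ⟨j', rfl⟩ := hI j (hj ▸ hw)
    rcases Relation.ReflTransGen.cases_head hij with hij | ⟨g, ⟨i₂, o₂, h1, h2, h3⟩, hg⟩
    · rw [← hi, G.sI_inj hij, hj]
      exact hw
    · obtain rfl := G.sI_inj h1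
      obtain ⟨n, p, hp, hp'⟩ := exists_line_hom hg
      -- The path runs from the edge between `y` and `u` to an input of `w`. Its end edges lie in
      -- `H`, and its first vertex is `u`.
      obtain ⟨p', e1, e2, e3⟩ := exists_line_hom_cons p h3 (hp.trans h2.symm)
      obtain ⟨q, -, -, hq⟩ := hc.lift _ (line_isLinear (n + 1)) ⟨0⟩ ⟨Fin.last _⟩
        ((line_input_iff _).2 rfl) ((line_output_iff _).2 rfl) p' (H.sO o') (H.sI j')
        (by rw [h.comm_sO, e1, hoi]) (by rw [h.comm_sI, e2, hp'])
      refine ⟨q.fV ⟨0⟩, ?_⟩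
      rw [← hi, ← e3, ← hq]
      rfl

/-- Recognition of convex inclusions. -/
theorem isConvex_of_mem_range (hG : G.IsAcyclic) {h : H ⟶ G} (injE : Function.Injective h.fE)
    (injI : Function.Injective h.fI) (injO : Function.Injective h.fO)
    (injV : Function.Injective h.fV)
    (hI : ∀ i, G.tI i ∈ Set.range h.fV → i ∈ Set.range h.fI)
    (hO : ∀ o, G.tO o ∈ Set.range h.fV → o ∈ Set.range h.fO)
    (hE : Nonempty H.V → ∀ e, e ∈ Set.range H.sI ∨ e ∈ Set.range H.sO)
    (hE' : IsEmpty H.V → Subsingleton H.E)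
    (hc : ∀ v u w, v ∈ Set.range h.fV → w ∈ Set.range h.fV → Relation.ReflTransGen G.Adj v u →
      Relation.ReflTransGen G.Adj u w → u ∈ Set.range h.fV) : IsConvex h := by
  refine ⟨injE, injI, injO, injV, fun L hL i o hi ho p a b ha hb => ?_⟩
  have hV : ∀ x, p.fV x ∈ Set.range h.fV := by
    intro x
    rcases isEmpty_or_nonempty H.V with hH | hH
    · have := (hE' hH).elim a b
      exact (hG.2 L hL ⟨x⟩ p i o hi ho (by rw [← ha, ← hb, this])).elim
    -- Each vertex of the path is traced back to the input edge, and that edge is attached to a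
    -- vertex of `H`: either the first vertex of the path or its predecessor. `hdown` is dual.
    have hup : ∀ v x, p.fV x = v → ∃ w ∈ Set.range h.fV, Relation.ReflTransGen G.Adj w v := by
      intro v
      induction v using hG.wellFounded.induction with
      | _ v ih =>
        rintro x rfl
        obtain ⟨k, rfl, -⟩ := hL.in_vertex x
        by_cases hk : L.sI k ∈ L.inputs
        · have hki : L.sI k = i := hL.input.unique hk hi
          rcases hE hH a with ⟨j, rfl⟩ | ⟨j, rfl⟩
          · have : h.fI j = p.fI k := G.sI_inj (by rw [← h.comm_sI, ha, ← hki, p.comm_sI])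
            exact ⟨_, ⟨H.tI j, by rw [h.comm_tI, this, p.comm_tI]⟩, .refl⟩
          · exact ⟨_, ⟨H.tO j, rfl⟩, .single ⟨h.fO j, p.fI k, (h.comm_tO j).symm,
              (p.comm_tI k).symm, by rw [← h.comm_sO, ha, ← hki, p.comm_sI]⟩⟩
        · obtain ⟨j, hj⟩ := not_not.1 hk
          have hadj : G.Adj (p.fV (L.tO j)) (p.fV (L.tI k)) :=
            ⟨p.fO j, p.fI k, (p.comm_tO j).symm, (p.comm_tI k).symm, by
              rw [← p.comm_sO, hj, p.comm_sI]⟩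
          obtain ⟨w, hw, hw'⟩ := ih _ hadj _ rfl
          exact ⟨w, hw, hw'.tail hadj⟩
    have hdown : ∀ v x, p.fV x = v → ∃ w ∈ Set.range h.fV, Relation.ReflTransGen G.Adj v w := by
      intro v
      induction v using hG.wellFounded_swap.induction with
      | _ v ih =>
        rintro x rfl
        obtain ⟨k, rfl, -⟩ := hL.out_vertex x
        by_cases hk : L.sO k ∈ L.outputs
        · have hki : L.sO k = o := hL.output.unique hk ho
          rcases hE hH b with ⟨j, rfl⟩ | ⟨j, rfl⟩
          · exact ⟨_, ⟨H.tI j, rfl⟩, .single ⟨p.fO k, h.fI j, (p.comm_tO k).symm,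
              (h.comm_tI j).symm, by rw [← h.comm_sI, hb, ← hki, p.comm_sO]⟩⟩
          · have : h.fO j = p.fO k := G.sO_inj (by rw [← h.comm_sO, hb, ← hki, p.comm_sO])
            exact ⟨_, ⟨H.tO j, by rw [h.comm_tO, this, p.comm_tO]⟩, .refl⟩
        · obtain ⟨j, hj⟩ := not_not.1 hk
          have hadj : G.Adj (p.fV (L.tO k)) (p.fV (L.tI j)) :=
            ⟨p.fO k, p.fI j, (p.comm_tO k).symm, (p.comm_tI j).symm, by
              rw [← p.comm_sO, ← hj, p.comm_sI]⟩
          obtain ⟨w, hw, hw'⟩ := ih _ hadj _ rfl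
          exact ⟨w, hw, hw'.head hadj⟩
    obtain ⟨v, hv, hv'⟩ := hup _ x rfl
    obtain ⟨w, hw, hw'⟩ := hdown _ x rfl
    exact hc v _ w hv hw hv' hw'
  choose qV hqV using hV
  choose qI hqI using fun k : L.I => hI (p.fI k) (by rw [← p.comm_tI, ← hqV]; exact ⟨_, rfl⟩)
  choose qO hqO using fun k : L.O => hO (p.fO k) (by rw [← p.comm_tO, ← hqV]; exact ⟨_, rfl⟩)
  have hqE : ∀ e, ∃ c, h.fE c = p.fE e := fun e => by
    by_cases he : e ∈ L.outputs
    · exact ⟨b, by rw [hb, hL.output.unique he ho]⟩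
    · obtain ⟨k, rfl⟩ := not_not.1 he
      exact ⟨H.sI (qI k), by rw [h.comm_sI, hqI, p.comm_sI]⟩
  choose qE hqE using hqE
  refine ⟨{ fE := qE, fI := qI, fO := qO, fV := qV
            comm_sI := fun k => injE (by rw [hqE, p.comm_sI, h.comm_sI, hqI])
            comm_sO := fun k => injE (by rw [hqE, p.comm_sO, h.comm_sO, hqO])
            comm_tI := fun k => injV (by rw [hqV, p.comm_tI, h.comm_tI, hqI])
            comm_tO := fun k => injV (by rw [hqV, p.comm_tO, h.comm_tO, hqO]) },
    injE ((hqE i).trans ha.symm), injE ((hqE o).trans hb.symm), ?_⟩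
  exact Hom.ext (funext hqE) (funext hqI) (funext hqO) (funext hqV)

end DiGraph

/-! ### Signs of arcs and directed adjacency -/

theorem Orientation.sign_inv' {G : Graph.{u}} (x : Orientation G) (a : G.A) :
    x.sign (G.inv a) = - x.sign a := by
  rw [x.sign_inv a, neg_neg]

theorem Graph.Edge.mk_eq_iff {G : Graph.{u}} {a b : G.A} :
    Edge.mk G a = Edge.mk G b ↔ a = b ∨ a = G.inv b :=
  ⟨fun h => Quotient.exact h, fun h => Quotient.sound h⟩

theorem units_ne_neg_self (s : ℤˣ) : s ≠ -s := by
  rcases Int.units_eq_one_or s with rfl | rfl <;> decide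

theorem Orientation.eq_of_mk_eq {G : Graph.{u}} (x : Orientation G) {a b : G.A}
    (h : Edge.mk G a = Edge.mk G b) (hs : x.sign a = x.sign b) : a = b := by
  rcases Edge.mk_eq_iff.1 h with h | h
  · exact h
  · rw [h, x.sign_inv'] at hs
    exact (units_ne_neg_self _ hs.symm).elim

/-- Adjacency of vertices: for `s = -1` there is an edge from `v` to `w`, for `s = 1` there is one
from `w` to `v`. -/
def Orientation.Adj {G : Graph.{u}} (x : Orientation G) (s : ℤˣ) (v w : G.V) : Prop :=
  ∃ d d', G.t d = v ∧ G.t d' = w ∧ G.incl d' = G.inv (G.incl d) ∧ x.sign (G.incl d') = s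

namespace Orientation

variable {G : Graph.{u}} (x : Orientation G)

theorem adj_neg {s : ℤˣ} {v w : G.V} : x.Adj (-s) v w ↔ x.Adj s w v := by
  constructor
  · rintro ⟨d, d', h1, h2, h3, h4⟩
    exact ⟨d', d, h2, h1, by rw [h3, G.inv_inv], by
      rw [h3, x.sign_inv', neg_inj] at h4
      exact h4⟩
  · rintro ⟨d, d', h1, h2, h3, h4⟩
    exact ⟨d', d, h2, h1, by rw [h3, G.inv_inv], by rw [x.sign_inv, ← h3, h4]⟩

theorem adj_neg_one : x.Adj (-1) = (toDi G x).Adj := by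
  funext v w
  refine propext ⟨?_, ?_⟩
  · rintro ⟨d, d', h1, h2, h3, h4⟩
    refine ⟨⟨d, ?_⟩, ⟨d', h4⟩, h1, h2,
      Edge.mk_eq_iff.2 (Or.inr (inv_eq_iff.1 h3.symm))⟩
    rw [x.sign_inv, ← h3, h4, neg_neg]
  · rintro ⟨⟨d, hd⟩, ⟨d', hd'⟩, h1, h2, h3⟩
    refine ⟨d, d', h1, h2, ?_, hd'⟩
    rcases Edge.mk_eq_iff.1 h3 with h | h
    · rw [h, hd'] at hd
      exact absurd hd (by decide)
    · rw [h, G.inv_inv]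

theorem reflTransGen_adj_neg {s : ℤˣ} {v w : G.V} :
    Relation.ReflTransGen (x.Adj (-s)) v w ↔ Relation.ReflTransGen (x.Adj s) w v := by
  have : x.Adj (-s) = Function.swap (x.Adj s) := by
    funext v w
    exact propext x.adj_neg
  rw [this, Relation.reflTransGen_swap]

theorem wellFounded_adj (hx : (toDi G x).IsAcyclic) (s : ℤˣ) : WellFounded (x.Adj s) := by
  rcases Int.units_eq_one_or s with rfl | rfl
  · have : x.Adj 1 = Function.swap (toDi G x).Adj := by
      funext v w
      rw [← adj_neg_one]
      exact propext x.adj_neg.symm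
    rw [this]
    exact hx.wellFounded_swap
  · rw [adj_neg_one]
    exact hx.wellFounded

/-- Sets of vertices which are closed under directed paths. -/
def IsConvex (W : Set G.V) : Prop :=
  ∀ v u w, v ∈ W → w ∈ W → Relation.ReflTransGen (x.Adj (-1)) v u →
    Relation.ReflTransGen (x.Adj (-1)) u w → u ∈ W

theorem IsConvex.mem {x : Orientation G} {W : Set G.V} (h : x.IsConvex W) {s : ℤˣ} {v u w : G.V}
    (hv : v ∈ W) (hw : w ∈ W) (hvu : Relation.ReflTransGen (x.Adj s) v u)
    (huw : Relation.ReflTransGen (x.Adj s) u w) : u ∈ W := by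
  rcases Int.units_eq_one_or s with rfl | rfl
  · exact h w u v hw hv (x.reflTransGen_adj_neg.2 huw) (x.reflTransGen_adj_neg.2 hvu)
  · exact h v u w hv hw hvu huw

end Orientation

/-! ### Structured subgraphs as full convex embeddings -/

/-- An embedding is full when no edge between its vertices is cut. -/
def Emb.IsFull {G : Graph.{u}} (e : Emb G) : Prop := ∀ a ∈ e.bdry, a ∉ G.att e.verts

/-- Half-edges are already separated, and fullness prevents a boundary arc from lying over the same
arc as a half-edge. When there is a vertex, every arc is a half-edge or opposite to one. -/
theorem EmbRep.fA_inj_of_isFull {G : Graph.{u}} {f : EmbRep G} (hf : (Emb.mk f).IsFull) :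
    Function.Injective f.map.fA := by
  have h1 : ∀ b, b ∈ f.dom.boundary → f.map.fA b ∉ G.att (Set.range f.map.fV) := fun b hb =>
    hf _ ⟨b, hb, rfl⟩
  have h2 : ∀ d b, f.map.fA (f.dom.incl d) = f.map.fA b → f.dom.incl d = b := by
    intro d b hdb
    by_cases hb : b ∈ Set.range f.dom.incl
    · obtain ⟨e, rfl⟩ := hb
      rw [f.eq_of_fA_incl hdb]
    · exact (h1 b hb (hdb ▸ f.fA_incl_mem d)).elim
  intro a b hab
  rcases isEmpty_or_nonempty f.dom.V with hV | hV
  · rcases f.conn.eq_or_eq_inv hV a b with rfl | rfl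
    · rfl
    · rw [f.map.comm_inv] at hab
      exact (G.inv_ne _ hab.symm).elim
  · rcases f.conn.incl_or hV a with ⟨d, rfl⟩ | ⟨d, hd⟩
    · exact h2 d b hab
    · have := h2 d (f.dom.inv b) (by rw [hd, f.map.comm_inv, f.map.comm_inv, hab])
      rw [← f.dom.inv_inv a, ← hd, this, f.dom.inv_inv]

namespace OGraph

variable {X : OGraph.{u}}

/-- Structured subgraphs are the full embeddings whose vertices are closed under directed paths. -/
theorem mem_sSb_iff (hX : X.di.IsAcyclic) {e : Emb X.graph} :
    e ∈ X.sSb ↔ e.IsFull ∧ X.orient.IsConvex e.verts := by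
  have hI : ∀ (f : EmbRep X.graph) (i : X.di.I),
      X.di.tI i ∈ Set.range (toDiMap f.map X.orient).fV →
      i ∈ Set.range (toDiMap f.map X.orient).fI := by
    rintro f ⟨d, hd⟩ h
    obtain ⟨d', rfl⟩ := f.exists_fD h
    exact ⟨⟨d', by rw [← f.map.comm_incl] at hd; exact hd⟩, rfl⟩
  have hO : ∀ (f : EmbRep X.graph) (i : X.di.O),
      X.di.tO i ∈ Set.range (toDiMap f.map X.orient).fV →
      i ∈ Set.range (toDiMap f.map X.orient).fO := by
    rintro f ⟨d, hd⟩ h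
    obtain ⟨d', rfl⟩ := f.exists_fD h
    exact ⟨⟨d', by rw [← f.map.comm_incl] at hd; exact hd⟩, rfl⟩
  constructor
  · rintro ⟨f, rfl, hf⟩
    constructor
    · rintro _ ⟨b, hb, rfl⟩ h
      obtain ⟨d, hd⟩ := f.exists_incl h
      -- A cut edge would be covered by two edges of the domain.
      have : Edge.mk f.dom (f.dom.incl d) = Edge.mk f.dom b :=
        hf.injE (congrArg (Edge.mk X.graph) hd)
      rcases Edge.mk_eq_iff.1 this with h' | h'
      · exact hb ⟨d, h'⟩
      · rw [h', f.map.comm_inv] at hd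
        exact X.graph.inv_ne _ hd
    · intro v u w hv hw hvu huw
      rw [Orientation.adj_neg_one] at hvu huw
      exact hf.mem_range (hI f) (hO f) hv hw hvu huw
  · rintro ⟨hf, hc⟩
    obtain ⟨f, rfl⟩ := e.exists_rep
    have hA := EmbRep.fA_inj_of_isFull hf
    refine ⟨f, rfl, DiGraph.isConvex_of_mem_range hX ?_ ?_ ?_ f.inj (hI f) (hO f) ?_ ?_ ?_⟩
    · intro a b hab
      induction a using Quotient.inductionOn with | _ a => ?_
      induction b using Quotient.inductionOn with | _ b => ?_
      have hab : Edge.mk X.graph (f.map.fA a) = Edge.mk X.graph (f.map.fA b) := hab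
      refine Edge.mk_eq_iff.2 ?_
      rcases Edge.mk_eq_iff.1 hab with h | h
      · exact Or.inl (hA h)
      · rw [← f.map.comm_inv] at h
        exact Or.inr (hA h)
    · exact fun d d' h => Subtype.ext (f.fD_inj (congrArg Subtype.val h))
    · exact fun d d' h => Subtype.ext (f.fD_inj (congrArg Subtype.val h))
    · intro hV a
      induction a using Quotient.inductionOn with | _ a => ?_
      have key : ∀ d, Edge.mk f.dom (f.dom.incl d) = Edge.mk f.dom a →
          Edge.mk f.dom a ∈ Set.range (toDi f.dom (X.orient.pull f.map.fA f.map.comm_inv)).sI ∨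
          Edge.mk f.dom a ∈ Set.range (toDi f.dom (X.orient.pull f.map.fA f.map.comm_inv)).sO := by
        intro d hd
        rcases Int.units_eq_one_or
          ((X.orient.pull f.map.fA f.map.comm_inv).sign (f.dom.incl d)) with h | h
        · exact Or.inr ⟨⟨d, h⟩, hd⟩
        · exact Or.inl ⟨⟨d, h⟩, hd⟩
      rcases f.conn.incl_or hV a with ⟨d, hd⟩ | ⟨d, hd⟩
      · exact key d (by rw [hd])
      · exact key d (Edge.mk_eq_iff.2 (Or.inr hd))
    · intro hV
      refine ⟨fun a b => ?_⟩
      induction a using Quotient.inductionOn with | _ a => ?_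
      induction b using Quotient.inductionOn with | _ b => ?_
      exact Edge.mk_eq_iff.2 (f.conn.eq_or_eq_inv hV b a)
    · intro v u w hv hw hvu huw
      rw [← Orientation.adj_neg_one] at hvu huw
      exact hc v u w hv hw hvu huw

end OGraph

/-! ### Maps of U are determined by arcs and stars -/

theorem Emb.isUnion_of_le {G : Graph.{u}} {h l : Emb G} (hl : h.le l) : Emb.IsUnion l l h :=
  ⟨l.le_refl, hl, (Set.union_eq_left.2 (Emb.verts_subset_of_le hl)).symm⟩

/-- A boundary arc of a full `e'` whose opposite is attached to `e` is attached to no vertex of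
`e'`, hence to none of `e`; so `e` has it in its boundary too. -/
theorem Emb.IsFull.le {G : Graph.{u}} {e e' : Emb G} (he : e'.IsFull) (hn : e.verts.Nonempty)
    (hV : e.verts ⊆ e'.verts) : e.le e' := by
  refine Emb.le_of_nonempty hn hV fun a ha ha' => ?_
  by_contra hc
  have := ((Emb.isEmbData hn).inner _ ha' (by rwa [G.inv_inv])).1
  rw [G.inv_inv] at this
  exact he a ha (att_mono hV this)

namespace UHom

variable {G G' : UGraph.{u}} (φ : UHom G G')

theorem hat_le {h l : Emb G.graph} (hl : h.le l) : (φ.hat h).le (φ.hat l) :=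
  (φ.unions l l h (Emb.isUnion_of_le hl)).2.1

/-- Attaching a star exhibits a union of the old embedding with the star, and gluing exhibits a
union of the old embedding with itself. Preservation of unions does the rest. -/
theorem verts_hat (h : Emb G.graph) :
    (φ.hat h).verts = ⋃ v ∈ h.verts, (φ.hat (Emb.star v)).verts := by
  rcases h.verts.eq_empty_or_nonempty with hn | ⟨v, hv⟩
  · rw [hn, Set.biUnion_empty]
    exact φ.edges h hn
  · refine Emb.induction_of_le (h := Emb.star v)
      (P := fun k => (φ.hat k).verts = ⋃ v ∈ k.verts, (φ.hat (Emb.star v)).verts) (by simp) (Emb.star_le hv)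
      (fun k k' w a _ hk hw _ _ _ hV _ ih => ?_) (fun k k' a _ hk _ _ hV _ ih => ?_) (by simp)
    · rw [(φ.unions k' k (Emb.star w) ⟨hk, hw, by rw [hV, Emb.verts_star]⟩).2.2, ih, hV,
        Set.biUnion_union, Set.biUnion_singleton]
    · rw [(φ.unions k' k k ⟨hk, hk, by rw [hV, Set.union_self]⟩).2.2, ih, hV, Set.union_self]

theorem eq_of_mem_verts_hat {v w : G.graph.V} {u : G'.graph.V}
    (hv : u ∈ (φ.hat (Emb.star v)).verts) (hw : u ∈ (φ.hat (Emb.star w)).verts) : v = w := by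
  by_contra hne
  have := φ.disjoint (Emb.star v) (Emb.star w)
    (by simpa [Emb.VertexDisjoint] using fun h => hne h.symm)
  exact Set.eq_empty_iff_forall_notMem.1 this u ⟨hv, hw⟩

/-- A map in `U` is determined by its values on arcs and stars. -/
theorem ext_star {φ ψ : UHom G G'} (harc : φ.arc = ψ.arc)
    (hstar : ∀ v, φ.hat (Emb.star v) = ψ.hat (Emb.star v)) : φ = ψ := by
  refine UHom.ext harc (funext fun h => Emb.ext_verts_bdry ?_ ?_)
  · rw [φ.verts_hat h, ψ.verts_hat h]
    simp only [hstar]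
  · rw [← (φ.bdry h).image_eq, ← (ψ.bdry h).image_eq, harc]

end UHom

/-! ### Structured maps preserve structured subgraphs -/

namespace OHom

variable {X Y : OGraph.{u}} (φ : OHom X Y)

theorem sign_arc (a : X.graph.A) : Y.orient.sign (φ.hom.arc a) = X.orient.sign a :=
  congrFun (congrArg Orientation.sign φ.orient) a

/-- Any half-edge at a vertex of the image of `top` which comes from an arc `a` belongs to the image
of the star of a vertex that can be reached from `a`. -/
theorem exists_mem_att_hat_star (hX : X.di.IsAcyclic)
    (hK : (φ.hom.hat (Emb.top X.graph X.U.conn)).IsFull) {a : X.graph.A}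
    (ha : φ.hom.arc a ∈ Y.graph.att (φ.hom.hat (Emb.top X.graph X.U.conn)).verts) :
    ∃ d v, X.graph.incl d = a ∧
      Relation.ReflTransGen (X.orient.Adj (X.orient.sign a)) (X.graph.t d) v ∧
      φ.hom.arc a ∈ Y.graph.att (φ.hom.hat (Emb.star v)).verts := by
  -- A boundary arc of `X` is sent to a boundary arc of the image of `top`, which by fullness is not
  -- attached to its vertices.
  have hb : ∀ a, φ.hom.arc a ∈ Y.graph.att (φ.hom.hat (Emb.top X.graph X.U.conn)).verts →
      ∃ d, X.graph.incl d = a := fun a ha => by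
    by_contra hc
    exact hK _ ((φ.hom.bdry _).mapsTo ((Emb.bdry_top X.U.conn).symm ▸ hc)) ha
  suffices ∀ v d, X.graph.t d = v → X.orient.sign (X.graph.incl d) = X.orient.sign a →
      φ.hom.arc (X.graph.incl d) = φ.hom.arc a →
      ∃ v, Relation.ReflTransGen (X.orient.Adj (X.orient.sign a)) (X.graph.t d) v ∧
        φ.hom.arc a ∈ Y.graph.att (φ.hom.hat (Emb.star v)).verts by
    obtain ⟨d, rfl⟩ := hb a ha
    obtain ⟨v, hv⟩ := this _ d rfl rfl rfl
    exact ⟨d, v, rfl, hv⟩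
  -- As long as the star at the current vertex is sent to an edge, the walk crosses it to the arc on
  -- the other side with the same image and sign; acyclicity bounds the walk.
  intro v
  induction v using (X.orient.wellFounded_adj hX (-X.orient.sign a)).induction with
  | _ v ih =>
    rintro d rfl hs hd
    have h1 := (φ.hom.bdry _).mapsTo (Emb.inv_incl_mem_bdry_star d)
    rw [φ.hom.arc_inv, hd] at h1
    rcases (φ.hom.hat (Emb.star (X.graph.t d))).verts.eq_empty_or_nonempty with hn | hn
    · have h2 : φ.hom.arc a ∈ (φ.hom.hat (Emb.star (X.graph.t d))).bdry := by
        rw [Emb.bdry_eq_of_mem hn h1, Y.graph.inv_inv]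
        exact Or.inr rfl
      obtain ⟨c, hc, hca⟩ := (φ.hom.bdry _).surjOn h2
      have hsc : X.orient.sign c = X.orient.sign a := by
        rw [← φ.sign_arc, hca, φ.sign_arc]
      obtain ⟨e, rfl⟩ := hb c (hca ▸ ha)
      obtain ⟨d₀, h3, h4⟩ := Emb.mem_bdry_star.1 hc
      have hadj : X.orient.Adj (X.orient.sign a) (X.graph.t d) (X.graph.t e) :=
        ⟨d₀, e, h4, rfl, by rw [h3, X.graph.inv_inv], hsc⟩
      obtain ⟨v, hv, hv'⟩ := ih _ (X.orient.adj_neg.2 hadj) e rfl hsc hca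
      exact ⟨v, hv.head hadj, hv'⟩
    · refine ⟨_, .refl, ?_⟩
      have := (Emb.isEmbData hn).inv_mem _ h1
      rwa [Y.graph.inv_inv] at this

theorem exists_reachable (hX : X.di.IsAcyclic)
    (hK : (φ.hom.hat (Emb.top X.graph X.U.conn)).IsFull) {s : ℤˣ} {v u : Y.graph.V}
    (h : Relation.ReflTransGen (Y.orient.Adj s) v u)
    (hu : ∀ w, Relation.ReflTransGen (Y.orient.Adj s) v w →
      Relation.ReflTransGen (Y.orient.Adj s) w u →
      w ∈ (φ.hom.hat (Emb.top X.graph X.U.conn)).verts)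
    {y : X.graph.V} (hv : v ∈ (φ.hom.hat (Emb.star y)).verts) :
    ∃ z, Relation.ReflTransGen (X.orient.Adj s) y z ∧ u ∈ (φ.hom.hat (Emb.star z)).verts := by
  induction h with
  | refl => exact ⟨y, .refl, hv⟩
  | tail h0 hadj ih =>
    obtain ⟨z, hz, hz'⟩ := ih fun w h1 h2 => hu w h1 (h2.tail hadj)
    have hmem := hu _ (h0.tail hadj) .refl
    obtain ⟨d, d', rfl, rfl, hi, hs⟩ := hadj
    have hd : Y.graph.incl d ∈ Y.graph.att (φ.hom.hat (Emb.star z)).verts := ⟨d, rfl, hz'⟩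
    -- An edge leaving the image of the star of `z` comes from a boundary arc of that star, from
    -- which the walk continues; an edge that is not cut stays at `z`.
    by_cases hB : Y.graph.incl d' ∈ (φ.hom.hat (Emb.star z)).bdry
    · obtain ⟨c, hc, hcd⟩ := (φ.hom.bdry _).surjOn hB
      have hsc : X.orient.sign c = s := by rw [← φ.sign_arc, hcd, hs]
      obtain ⟨e, w, rfl, hw, hw'⟩ := φ.exists_mem_att_hat_star hX hK (a := c)
        (by rw [hcd]; exact ⟨d', rfl, hmem⟩)
      obtain ⟨d₀, h3, h4⟩ := Emb.mem_bdry_star.1 hc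
      rw [hsc] at hw
      refine ⟨w, hz.trans (hw.head ⟨d₀, e, h4, rfl, by rw [h3, X.graph.inv_inv], hsc⟩), ?_⟩
      rw [hcd] at hw'
      exact incl_mem_att.1 hw'
    · rw [hi] at hB
      have := ((Emb.isEmbData ⟨_, hz'⟩).inner _ hd hB).1
      rw [← hi] at this
      exact ⟨z, hz, incl_mem_att.1 this⟩

/-- If the image of `top` is a structured subgraph, then so are the images of all structured
subgraphs. -/
theorem hat_mem_sSb (hX : X.di.IsAcyclic) (hY : Y.di.IsAcyclic)
    (hφ : φ.hom.hat (Emb.top X.graph X.U.conn) ∈ Y.sSb) {H : Emb X.graph} (hH : H ∈ X.sSb) :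
    φ.hom.hat H ∈ Y.sSb := by
  rw [OGraph.mem_sSb_iff hY] at hφ ⊢
  rw [OGraph.mem_sSb_iff hX] at hH
  obtain ⟨hKf, hKc⟩ := hφ
  obtain ⟨hHf, hHc⟩ := hH
  have hsub := Emb.verts_subset_of_le (φ.hom.hat_le (Emb.le_top X.U.conn H))
  have hex : ∀ {u}, u ∈ (φ.hom.hat H).verts →
      ∃ v ∈ H.verts, u ∈ (φ.hom.hat (Emb.star v)).verts := fun hu => by
    rw [φ.hom.verts_hat] at hu
    simpa using hu
  constructor
  · intro b hb hbW
    obtain ⟨a, ha, rfl⟩ := (φ.hom.bdry H).surjOn hb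
    obtain ⟨d, v, rfl, hv, hv'⟩ := φ.exists_mem_att_hat_star hX hKf (att_mono hsub hbW)
    obtain ⟨e, he, he'⟩ := hbW
    obtain ⟨w, hw, hw'⟩ := hex he'
    rw [← he] at hv'
    -- The walk starting at `a` ends at a vertex of `H`, and the opposite of `a` is attached to `H`.
    -- Convexity puts the vertex at `a` between them into `H`, against fullness of `H`.
    obtain rfl := φ.hom.eq_of_mem_verts_hat hw' (incl_mem_att.1 hv')
    obtain ⟨d₀, h1, h2⟩ := (Emb.isEmbData ⟨w, hw⟩).inv_mem _ ha
    refine hHf _ ha ⟨d, rfl, hHc.mem h2 hw (.single ?_) hv⟩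
    exact ⟨d₀, d, rfl, rfl, by rw [h1, X.graph.inv_inv], rfl⟩
  · intro v u w hv hw hvu huw
    have hK : ∀ z, Relation.ReflTransGen (Y.orient.Adj (-1)) v z →
        Relation.ReflTransGen (Y.orient.Adj (-1)) z w →
        z ∈ (φ.hom.hat (Emb.top X.graph X.U.conn)).verts := fun z h h' =>
      hKc v z w (hsub hv) (hsub hw) h h'
    obtain ⟨y, hy, hy'⟩ := hex hv
    obtain ⟨z, hz, hz'⟩ := hex hw
    obtain ⟨p, hp, hp'⟩ := φ.exists_reachable hX hKf hvu
      (fun x h1 h2 => hK x h1 (h2.trans huw)) hy'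
    obtain ⟨q, hq, hq'⟩ := φ.exists_reachable hX hKf (s := 1) (v := w) (u := u)
      (Y.orient.reflTransGen_adj_neg.1 huw)
      (fun x h1 h2 => hK x (hvu.trans (Y.orient.reflTransGen_adj_neg.2 h2))
        (Y.orient.reflTransGen_adj_neg.2 h1)) hz'
    -- The forward lift from `v` and the backward lift from `w` both end at the unique vertex whose
    -- star has `u` in its image.
    obtain rfl := φ.hom.eq_of_mem_verts_hat hp' hq'
    rw [φ.hom.verts_hat]
    exact Set.mem_biUnion (hHc y p z hy hz hp (X.orient.reflTransGen_adj_neg.2 hq)) hp'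

end OHom

/-! ### Unions of subgraphs against unions of embeddings, and the restriction -/

namespace OGraph

variable {X : OGraph.{u}}

theorem mk_mem_image_edges {e : Emb X.graph} {a : X.graph.A} :
    Edge.mk X.graph a ∈ (X.image e).edges ↔ a ∈ e.arcs := by
  constructor
  · rintro ⟨b, hb, hba⟩
    rcases Edge.mk_eq_iff.1 hba with rfl | rfl
    · exact hb
    · simpa [X.graph.inv_inv] using Emb.inv_mem_arcs hb
  · exact fun h => ⟨a, h, rfl⟩

theorem le_of_arcs_subset {e e' : Emb X.graph} (he : e'.IsFull) (hA : e.arcs ⊆ e'.arcs)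
    (hV : e.verts ⊆ e'.verts) : e.le e' := by
  rcases e.verts.eq_empty_or_nonempty with h | h
  · exact Emb.le_of_empty h (e.bdry_subset_arcs.trans hA)
  · exact he.le h hV

/-- The arcs of a union. -/
theorem arcs_eq_of_isUnion {e h k : Emb X.graph} (hu : Emb.IsUnion e h k) :
    e.arcs = h.arcs ∪ k.arcs := by
  refine Set.Subset.antisymm (fun a ha => ?_)
    (Set.union_subset (Emb.arcs_subset_of_le hu.1) (Emb.arcs_subset_of_le hu.2.1))
  rcases e.verts.eq_empty_or_nonempty with hn | hn
  · obtain ⟨b, -, hb⟩ := Emb.exists_edge hn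
    obtain ⟨c, -, hc⟩ := Emb.exists_edge (Set.subset_empty_iff.1
      (hn ▸ Emb.verts_subset_of_le hu.1))
    have hce : c ∈ e.arcs := Emb.arcs_subset_of_le hu.1 (by rw [hc]; exact Or.inl rfl)
    refine Or.inl ?_
    rw [hb] at ha hce
    rw [hc]
    rcases hce with rfl | rfl
    · exact ha
    · rwa [X.graph.inv_inv, Set.pair_comm]
  · have key : ∀ {a}, a ∈ X.graph.att e.verts → a ∈ h.arcs ∪ k.arcs := fun {a} ha => by
      rw [hu.2.2, att_union] at ha
      rcases ha with ha | ha
      · exact Or.inl ((Emb.mem_arcs (by obtain ⟨d, -, hd⟩ := ha; exact ⟨_, hd⟩)).2 (Or.inl ha))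
      · exact Or.inr ((Emb.mem_arcs (by obtain ⟨d, -, hd⟩ := ha; exact ⟨_, hd⟩)).2 (Or.inl ha))
    rcases (Emb.mem_arcs hn).1 ha with h1 | h1
    · exact key h1
    · rw [← X.graph.inv_inv a]
      exact (key h1).imp Emb.inv_mem_arcs Emb.inv_mem_arcs

/-- Images forget which edges are cut. Fullness of `J` is what turns inclusions of images into
factorizations. -/
theorem isUnion_of_image_eq {J H K : Emb X.graph} (hJ : J.IsFull)
    (h : X.image J = X.image H ∪ X.image K) : Emb.IsUnion J H K := by
  have hV : J.verts = H.verts ∪ K.verts := congrArg DiGraph.Subgraph.verts h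
  have hE : (X.image J).edges = (X.image H).edges ∪ (X.image K).edges :=
    congrArg DiGraph.Subgraph.edges h
  refine ⟨le_of_arcs_subset hJ (fun a ha => ?_) (hV ▸ Set.subset_union_left),
    le_of_arcs_subset hJ (fun a ha => ?_) (hV ▸ Set.subset_union_right), hV⟩
  · rw [← mk_mem_image_edges, hE]
    exact Or.inl (mk_mem_image_edges.2 ha)
  · rw [← mk_mem_image_edges, hE]
    exact Or.inr (mk_mem_image_edges.2 ha)

theorem image_eq_of_isUnion {J H K : Emb X.graph} (h : Emb.IsUnion J H K) :
    X.image J = X.image H ∪ X.image K := by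
  refine DiGraph.Subgraph.ext ?_ h.2.2
  change Edge.mk X.graph '' J.arcs = Edge.mk X.graph '' H.arcs ∪ Edge.mk X.graph '' K.arcs
  rw [arcs_eq_of_isUnion h, Set.image_union]

end OGraph

/-- Among arcs of a fixed sign, an arc is determined by its edge. -/
theorem bijOn_edge {X Y : OGraph.{u}} {arc : X.graph.A → Y.graph.A}
    (hinv : ∀ a, arc (X.graph.inv a) = Y.graph.inv (arc a))
    (hs : ∀ a, Y.orient.sign (arc a) = X.orient.sign a) {h : Emb X.graph} {k : Emb Y.graph}
    (hb : Set.BijOn arc h.bdry k.bdry) (s : ℤˣ) :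
    Set.BijOn (Edge.map arc hinv) (Edge.mk X.graph '' {a | a ∈ h.bdry ∧ X.orient.sign a = s})
      (Edge.mk Y.graph '' {a | a ∈ k.bdry ∧ Y.orient.sign a = s}) := by
  refine ⟨?_, ?_, ?_⟩
  · rintro _ ⟨a, ⟨ha, has⟩, rfl⟩
    exact ⟨arc a, ⟨hb.mapsTo ha, by rw [hs, has]⟩, rfl⟩
  · rintro _ ⟨a, ⟨ha, has⟩, rfl⟩ _ ⟨b, ⟨hb', hbs⟩, rfl⟩ hab
    have : arc a = arc b := Y.orient.eq_of_mk_eq hab (by rw [hs, hs, has, hbs])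
    rw [hb.injOn ha hb' this]
  · rintro _ ⟨b, ⟨hb', hbs⟩, rfl⟩
    obtain ⟨a, ha, rfl⟩ := hb.surjOn hb'
    exact ⟨_, ⟨a, ⟨ha, by rw [← hs, hbs]⟩, rfl⟩, rfl⟩

/-- The restriction of a map in `U/𝔬` to structured subgraphs. -/
def restrict {X Y : AcyclicGraph.{u}} (φ : X.graph ⟶ Y.graph)
    (hφ : φ.hom.hat (Emb.top X.graph.graph X.graph.U.conn) ∈ Y.graph.sSb) : X ⟶ Y where
  edge := Edge.map φ.hom.arc φ.hom.arc_inv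
  check H := ⟨φ.hom.hat H, OHom.hat_mem_sSb φ X.acyclic Y.acyclic hφ H.2⟩
  inp H := bijOn_edge φ.hom.arc_inv (OHom.sign_arc φ) (φ.hom.bdry H) 1
  out H := bijOn_edge φ.hom.arc_inv (OHom.sign_arc φ) (φ.hom.bdry H) (-1)
  union _ _ J h := OGraph.image_eq_of_isUnion (φ.hom.unions _ _ _
    (OGraph.isUnion_of_image_eq ((OGraph.mem_sSb_iff X.acyclic).1 J.2).1 h))

theorem top_mem_sSb {X : OGraph.{u}} (hX : X.di.IsAcyclic) :
    Emb.top X.graph X.U.conn ∈ X.sSb := by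
  rw [OGraph.mem_sSb_iff hX]
  constructor
  · rintro a ha ⟨d, hd, -⟩
    rw [Emb.bdry_top] at ha
    exact ha ⟨d, hd⟩
  · simp [Orientation.IsConvex]

/-! ### Substituting embeddings for the vertices of an acyclic graph -/

theorem bijOn_union {α β : Type*} {f : α → β} {s s' : Set α} {t t' : Set β}
    (h : Set.BijOn f s t) (h' : Set.BijOn f s' t') (hd : Disjoint t t') :
    Set.BijOn f (s ∪ s') (t ∪ t') := by
  refine h.union h' ?_
  rintro x (hx | hx) y (hy | hy) hxy
  · exact h.injOn hx hy hxy
  · exact (Set.disjoint_left.1 hd (h.mapsTo hx) (hxy ▸ h'.mapsTo hy)).elim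
  · exact (Set.disjoint_left.1 hd (h.mapsTo hy) (hxy ▸ h'.mapsTo hx)).elim
  · exact h'.injOn hx hy hxy

theorem union_sdiff_pair {α : Type*} {s t : Set α} {a b : α} (hd : Disjoint s t) (ha : a ∈ s)
    (hb : b ∈ t) : (s ∪ t) \ {a, b} = s \ {a} ∪ t \ {b} := by
  have h1 := Set.disjoint_left.1 hd ha
  have h2 := Set.disjoint_right.1 hd hb
  ext x
  simp only [Set.mem_sdiff, Set.mem_union, Set.mem_insert_iff, Set.mem_singleton_iff]
  constructor
  · rintro ⟨h | h, h'⟩ <;> simp_all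
  · rintro (⟨h, h'⟩ | ⟨h, h'⟩)
    · exact ⟨Or.inl h, by rintro (h3 | rfl) <;> contradiction⟩
    · exact ⟨Or.inr h, by rintro (rfl | h3) <;> contradiction⟩

namespace Emb

variable {G : Graph.{u}}

theorem disjoint_bdry {h k : Emb G} (hn : h.verts.Nonempty) (kn : k.verts.Nonempty)
    (hd : h.verts ∩ k.verts = ∅) : Disjoint h.bdry k.bdry :=
  Set.disjoint_left.2 fun a ha ha' => not_mem_att_empty
    (hd ▸ att_inter ((isEmbData hn).inv_mem a ha) ((isEmbData kn).inv_mem a ha'))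

theorem eq_of_le_of_empty {h l : Emb G} (hl : h.le l) (hV : l.verts = ∅) : h = l := by
  have hV' : h.verts = ∅ := Set.subset_empty_iff.1 (hV ▸ verts_subset_of_le hl)
  obtain ⟨a, ha, ha'⟩ := exists_edge hV'
  have : a ∈ l.bdry := by
    rw [← arcs_eq_bdry hV]
    exact arcs_subset_of_le hl (ha' ▸ Or.inl rfl)
  exact ext_verts_bdry (hV'.trans hV.symm) (by rw [ha, bdry_eq_of_mem hV this])

end Emb

/-- The data needed for substituting embeddings of `Y` for the vertices of `X`. -/
structure StarMap (X Y : OGraph.{u}) where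
  arc : X.graph.A → Y.graph.A
  arc_inv : ∀ a, arc (X.graph.inv a) = Y.graph.inv (arc a)
  sign_arc : ∀ a, Y.orient.sign (arc a) = X.orient.sign a
  star : X.graph.V → Emb Y.graph
  bdry : ∀ v, Set.BijOn arc (Emb.star v).bdry (star v).bdry
  disjoint : ∀ v w, v ≠ w → (star v).verts ∩ (star w).verts = ∅

namespace StarMap

variable {X Y : OGraph.{u}} (σ : StarMap X Y)

/-- `k` is the result of substituting into `h`. -/
def IsImage (h : Emb X.graph) (k : Emb Y.graph) : Prop :=
  k.verts = ⋃ v ∈ h.verts, (σ.star v).verts ∧ Set.BijOn σ.arc h.bdry k.bdry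

variable {σ}

theorem IsImage.unique {h : Emb X.graph} {k k' : Emb Y.graph} (hk : σ.IsImage h k)
    (hk' : σ.IsImage h k') : k = k' :=
  Emb.ext_verts_bdry (hk.1.trans hk'.1.symm) (hk.2.image_eq.symm.trans hk'.2.image_eq)

theorem isImage_star (v : X.graph.V) : σ.IsImage (Emb.star v) (σ.star v) :=
  ⟨by simp, σ.bdry v⟩

theorem exists_isImage_edge {h : Emb X.graph} (hV : h.verts = ∅) : ∃ k, σ.IsImage h k := by
  obtain ⟨a, ha, -⟩ := Emb.exists_edge hV
  obtain ⟨k, hk, hk'⟩ := exists_emb_edge (σ.arc a)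
  refine ⟨k, by simp [hV, hk], ?_⟩
  rw [ha, hk', ← σ.arc_inv]
  refine ⟨?_, ?_, ?_⟩
  · rintro _ (rfl | rfl)
    · exact Or.inl rfl
    · exact Or.inr rfl
  · have hne : σ.arc a ≠ σ.arc (X.graph.inv a) := by
      rw [σ.arc_inv]
      exact (Y.graph.inv_ne _).symm
    rintro _ (rfl | rfl) _ (rfl | rfl) h
    · rfl
    · exact (hne h).elim
    · exact (hne h.symm).elim
    · rfl
  · rintro _ (rfl | rfl)
    · exact ⟨_, Or.inl rfl, rfl⟩
    · exact ⟨_, Or.inr rfl, rfl⟩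

/-- Attaching removes one arc from each of two disjoint boundaries. The images are glued in the same
way, and a piece that has become an edge contributes nothing. -/
theorem IsImage.attach {k k' : Emb X.graph} {k₁ : Emb Y.graph} (hk : σ.IsImage k k₁)
    {v : X.graph.V} {a : X.graph.A} (kn : k.verts.Nonempty) (hv : v ∉ k.verts) (ha : a ∈ k.bdry)
    (ha' : X.graph.inv a ∈ (Emb.star v).bdry) (hV : k'.verts = k.verts ∪ {v})
    (hB : k'.bdry = (k.bdry ∪ (Emb.star v).bdry) \ {a, X.graph.inv a}) :
    ∃ k₁', σ.IsImage k' k₁' ∧ k₁.le k₁' := by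
  have hd := Emb.disjoint_bdry kn (by simp) (Emb.disjoint_star_of_notMem hv)
  have h1 : σ.arc a ∈ k₁.bdry := hk.2.mapsTo ha
  have h2 : Y.graph.inv (σ.arc a) ∈ (σ.star v).bdry := by
    rw [← σ.arc_inv]
    exact (σ.bdry v).mapsTo ha'
  have hV₁ : ⋃ v ∈ k'.verts, (σ.star v).verts = k₁.verts ∪ (σ.star v).verts := by
    rw [hV, Set.biUnion_union, Set.biUnion_singleton, hk.1]
  have hdis : k₁.verts ∩ (σ.star v).verts = ∅ := by
    rw [hk.1]
    refine Set.eq_empty_of_forall_notMem fun u ⟨hu, hu'⟩ => ?_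
    obtain ⟨w, hw, hu⟩ := Set.mem_iUnion₂.1 hu
    exact Set.eq_empty_iff_forall_notMem.1 (σ.disjoint w v fun h => hv (h ▸ hw)) u ⟨hu, hu'⟩
  suffices ∃ k₁' : Emb Y.graph, k₁'.verts = k₁.verts ∪ (σ.star v).verts ∧
      k₁'.bdry = k₁.bdry \ {σ.arc a} ∪ (σ.star v).bdry \ {Y.graph.inv (σ.arc a)} ∧
      Disjoint (k₁.bdry \ {σ.arc a}) ((σ.star v).bdry \ {Y.graph.inv (σ.arc a)}) ∧
      k₁.le k₁' by
    obtain ⟨k₁', e1, e2, e3, e4⟩ := this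
    refine ⟨k₁', ⟨by rw [hV₁, e1], ?_⟩, e4⟩
    rw [hB, union_sdiff_pair hd ha ha', e2]
    have := Set.BijOn.sdiff_singleton (σ.bdry v) ha'
    rw [σ.arc_inv] at this
    exact bijOn_union (Set.BijOn.sdiff_singleton hk.2 ha) this e3
  have hne := Y.graph.inv_ne (σ.arc a)
  -- If the star becomes an edge, its other end replaces the removed arc and `k₁` is unchanged; if
  -- `k₁` is an edge, the result is the image of the star.
  rcases (σ.star v).verts.eq_empty_or_nonempty with hs | hs
  · have : (σ.star v).bdry \ {Y.graph.inv (σ.arc a)} = {σ.arc a} := by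
      rw [Emb.bdry_eq_of_mem hs h2, Y.graph.inv_inv, Set.pair_sdiff_left hne]
    rw [this]
    refine ⟨k₁, by simp [hs], ?_, Set.disjoint_sdiff_left, k₁.le_refl⟩
    rw [Set.sdiff_union_of_subset (Set.singleton_subset_iff.2 h1)]
  rcases k₁.verts.eq_empty_or_nonempty with hk₁ | hk₁
  · have hb := Emb.bdry_eq_of_mem hk₁ h1
    have : k₁.bdry \ {σ.arc a} = {Y.graph.inv (σ.arc a)} := by
      rw [hb, Set.pair_sdiff_left hne.symm]
    rw [this]
    refine ⟨σ.star v, by simp [hk₁], ?_, Set.disjoint_sdiff_right,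
      Emb.le_of_empty_of_mem hk₁ (a := Y.graph.inv (σ.arc a)) ?_ (Emb.bdry_subset_arcs _ h2)⟩
    · rw [Set.union_sdiff_cancel (Set.singleton_subset_iff.2 h2)]
    · rw [hb]
      exact Or.inr rfl
  · have hd₁ := Emb.disjoint_bdry hk₁ hs hdis
    obtain ⟨k₁', e1, e2⟩ :=
      ((Emb.isEmbData hk₁).union (Emb.isEmbData hs) hdis h1 h2).exists_emb
    refine ⟨k₁', e1, by rw [e2, union_sdiff_pair hd₁ h1 h2],
      hd₁.mono Set.sdiff_subset Set.sdiff_subset,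
      Emb.le_of_nonempty hk₁ (by simp [e1]) fun x hx hx' => ?_⟩
    rw [e2] at hx
    exact hx.1.resolve_right fun h => not_mem_att_empty
      (hdis ▸ att_inter hx' ((Emb.isEmbData hs).inv_mem x h))

/-- Gluing the ends of an edge would give a loop without vertices, which is not an embedding. If
`k₁` were an edge, all stars of `k` would become edges, so each vertex of `k` would have an outgoing
edge, and that edge would lead back into `k`. -/
theorem IsImage.nonempty_of_glue (hX : X.di.IsAcyclic) {k : Emb X.graph} {k₁ : Emb Y.graph}
    (hk : σ.IsImage k k₁) {a : X.graph.A} (kn : k.verts.Nonempty) (ha : a ∈ k.bdry)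
    (ha' : X.graph.inv a ∈ k.bdry) : k₁.verts.Nonempty := by
  by_contra hc
  rw [Set.not_nonempty_iff_eq_empty] at hc
  have hb : ∀ b ∈ k.bdry, X.graph.inv b ∈ k.bdry := by
    intro b hb
    have h1 := hk.2.mapsTo hb
    rw [Emb.bdry_eq_of_mem hc (hk.2.mapsTo ha), ← σ.arc_inv] at h1
    rcases h1 with h1 | h1
    · rwa [hk.2.injOn hb ha h1]
    · rwa [hk.2.injOn hb ha' h1, X.graph.inv_inv]
  -- Minimality for sign `1` means that no edge runs from `v` to a vertex of `k`.
  obtain ⟨v, hv, hmin⟩ := (X.orient.wellFounded_adj hX 1).has_min k.verts kn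
  have hs : (σ.star v).verts = ∅ := by
    rw [hk.1] at hc
    exact Set.subset_empty_iff.1 (hc ▸
      Set.subset_biUnion_of_mem (u := fun v => (σ.star v).verts) hv)
  obtain ⟨c, hc, hcs⟩ : ∃ c ∈ (σ.star v).bdry, Y.orient.sign c = -1 := by
    obtain ⟨c, hc, -⟩ := Emb.exists_edge hs
    rcases Int.units_eq_one_or (Y.orient.sign c) with h | h
    · exact ⟨_, by rw [hc]; exact Or.inr rfl, by rw [Y.orient.sign_inv', h]⟩
    · exact ⟨c, by rw [hc]; exact Or.inl rfl, h⟩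
  obtain ⟨b, hbv, rfl⟩ := (σ.bdry v).surjOn hc
  rw [σ.sign_arc] at hcs
  obtain ⟨d, hd, hdv⟩ := Emb.mem_bdry_star.1 hbv
  obtain rfl : X.graph.t d = v := hdv
  have hbk : b ∈ X.graph.att k.verts := by
    by_cases h : b ∈ k.bdry
    · have := (Emb.isEmbData kn).inv_mem _ (hb b h)
      rwa [X.graph.inv_inv] at this
    · have := ((Emb.isEmbData kn).inner (X.graph.inv b) (hd ▸ ⟨d, rfl, hv⟩)
        (by rwa [X.graph.inv_inv])).1
      rwa [X.graph.inv_inv] at this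
  obtain ⟨e, rfl, he⟩ := hbk
  exact hmin _ he (X.orient.adj_neg.1 ⟨d, e, rfl, rfl, by rw [hd, X.graph.inv_inv], hcs⟩)

theorem IsImage.glue (hX : X.di.IsAcyclic) {k k' : Emb X.graph} {k₁ : Emb Y.graph}
    (hk : σ.IsImage k k₁) {a : X.graph.A} (kn : k.verts.Nonempty) (ha : a ∈ k.bdry)
    (ha' : X.graph.inv a ∈ k.bdry) (hV : k'.verts = k.verts)
    (hB : k'.bdry = k.bdry \ {a, X.graph.inv a}) : ∃ k₁', σ.IsImage k' k₁' ∧ k₁.le k₁' := by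
  have hn := hk.nonempty_of_glue hX kn ha ha'
  have h2 := hk.2.mapsTo ha'
  rw [σ.arc_inv] at h2
  obtain ⟨k₁', e1, e2⟩ := ((Emb.isEmbData hn).glue (hk.2.mapsTo ha) h2).exists_emb
  refine ⟨k₁', ⟨by rw [e1, hV, hk.1], ?_⟩, Emb.le_of_nonempty hn e1.ge fun x hx _ => ?_⟩
  · have := Set.BijOn.sdiff_singleton (Set.BijOn.sdiff_singleton hk.2 ha) (a := X.graph.inv a)
      ⟨ha', X.graph.inv_ne a⟩
    rw [hB, e2, Set.insert_eq, Set.insert_eq, ← Set.sdiff_sdiff, ← Set.sdiff_sdiff, ← σ.arc_inv]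
    exact this
  · rw [e2] at hx
    exact hx.1

theorem IsImage.exists_of_le (hX : X.di.IsAcyclic) {h l : Emb X.graph} {h₁ : Emb Y.graph}
    (hh : σ.IsImage h h₁) (hn : h.verts.Nonempty) (hl : h.le l) :
    ∃ l₁, σ.IsImage l l₁ ∧ h₁.le l₁ := by
  refine Emb.induction_of_le (P := fun l => ∃ l₁, σ.IsImage l l₁ ∧ h₁.le l₁) hn hl ?_ ?_
    ⟨h₁, hh, h₁.le_refl⟩
  · rintro k k' v a kn - - hv ha ha' hV hB ⟨k₁, hk, hle⟩
    obtain ⟨k₁', hk', hle'⟩ := hk.attach kn hv ha ha' hV hB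
    exact ⟨k₁', hk', Emb.le_trans hle hle'⟩
  · rintro k k' a kn - ha ha' hV hB ⟨k₁, hk, hle⟩
    obtain ⟨k₁', hk', hle'⟩ := hk.glue hX kn ha ha' hV hB
    exact ⟨k₁', hk', Emb.le_trans hle hle'⟩

theorem exists_isImage (hX : X.di.IsAcyclic) (h : Emb X.graph) : ∃ k, σ.IsImage h k := by
  rcases h.verts.eq_empty_or_nonempty with hn | ⟨v, hv⟩
  · exact exists_isImage_edge hn
  · obtain ⟨k, hk, -⟩ := (isImage_star (σ := σ) v).exists_of_le hX (by simp) (Emb.star_le hv)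
    exact ⟨k, hk⟩

theorem IsImage.le (hX : X.di.IsAcyclic) {h l : Emb X.graph} {h₁ l₁ : Emb Y.graph}
    (hh : σ.IsImage h h₁) (hl : σ.IsImage l l₁) (hle : h.le l) : h₁.le l₁ := by
  rcases h.verts.eq_empty_or_nonempty with hn | hn
  · rcases l.verts.eq_empty_or_nonempty with ln | ln
    · obtain rfl := Emb.eq_of_le_of_empty hle ln
      exact hh.unique hl ▸ h₁.le_refl
    obtain ⟨a, ha, haA⟩ := Emb.exists_edge hn
    -- The edge touches the star of some vertex of `l`, and it suffices that its image lies in the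
    -- image of that star.
    obtain ⟨b, hb, hbl⟩ : ∃ b ∈ h.bdry, X.graph.inv b ∈ X.graph.att l.verts := by
      rcases (Emb.mem_arcs ln).1 (Emb.arcs_subset_of_le hle (haA ▸ Or.inl rfl : a ∈ h.arcs))
        with h1 | h1
      · exact ⟨_, by rw [ha]; exact Or.inr rfl, by rwa [X.graph.inv_inv]⟩
      · exact ⟨a, by rw [ha]; exact Or.inl rfl, h1⟩
    obtain ⟨d, hd, hd'⟩ := hbl
    have hbs : b ∈ (Emb.star (X.graph.t d)).bdry := Emb.mem_bdry_star.2 ⟨d, hd, rfl⟩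
    obtain ⟨l₂, hl₂, hle₂⟩ := (isImage_star (σ := σ) (X.graph.t d)).exists_of_le hX (by simp)
      (Emb.star_le hd')
    rw [hl₂.unique hl] at hle₂
    refine Emb.le_of_empty_of_mem (by rw [hh.1, hn, Set.biUnion_empty]) (hh.2.mapsTo hb)
      (Emb.arcs_subset_of_le hle₂ (Emb.bdry_subset_arcs _ ((σ.bdry _).mapsTo hbs)))
  · obtain ⟨l₂, hl₂, hle₂⟩ := hh.exists_of_le hX hn hle
    rwa [hl₂.unique hl] at hle₂

variable (σ)

/-- The map of `U` obtained by substitution. -/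
noncomputable def toUHom (hX : X.di.IsAcyclic) : UHom X.U Y.U :=
  have hi (h : Emb X.graph) := (exists_isImage (σ := σ) hX h).choose_spec
  { arc := σ.arc
    hat := fun h => (exists_isImage (σ := σ) hX h).choose
    arc_inv := σ.arc_inv
    edges := fun h hh => by
      have hh : h.verts = ∅ := hh
      have := (hi h).1
      rwa [hh, Set.biUnion_empty] at this
    unions := fun l h k hu => by
      refine ⟨(hi h).le hX (hi l) hu.1, (hi k).le hX (hi l) hu.2.1, ?_⟩
      rw [(hi l).1, (hi h).1, (hi k).1, hu.2.2, Set.biUnion_union]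
    disjoint := fun h k hd => by
      refine Set.eq_empty_of_forall_notMem ?_
      rw [(hi h).1, (hi k).1]
      rintro u ⟨hu, hu'⟩
      obtain ⟨v, hv, hu⟩ := Set.mem_iUnion₂.1 hu
      obtain ⟨w, hw, hu'⟩ := Set.mem_iUnion₂.1 hu'
      have hvw : v ≠ w := by
        rintro rfl
        exact Set.eq_empty_iff_forall_notMem.1 hd v ⟨hv, hw⟩
      exact Set.eq_empty_iff_forall_notMem.1 (σ.disjoint v w hvw) u ⟨hu, hu'⟩
    bdry := fun h => (hi h).2 }

theorem isImage_toUHom (hX : X.di.IsAcyclic) (h : Emb X.graph) :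
    σ.IsImage h ((σ.toUHom hX).hat h) := (exists_isImage (σ := σ) hX h).choose_spec

end StarMap

/-! ### Existence and splitting of structured subgraphs -/

theorem Graph.isEmbData_full {G : Graph.{u}} {W : Set G.V} (hn : W.Nonempty)
    (conn : ∀ T ⊆ W, T.Nonempty →
      (∀ d d', G.t d ∈ T → G.t d' ∈ W → G.incl d' = G.inv (G.incl d) → G.t d' ∈ T) → T = W) :
    G.IsEmbData W {a | G.inv a ∈ G.att W ∧ a ∉ G.att W} where
  nonempty := hn
  inv_mem _ ha := ha.1
  inner a ha hB := by
    refine ⟨?_, fun h => h.2 ha⟩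
    by_contra hc
    exact hB ⟨show G.inv (G.inv a) ∈ G.att W by rwa [G.inv_inv], hc⟩
  conn T hT hTn hcl := conn T hT hTn fun d d' h1 h2 h3 =>
    hcl d d' h1 h2 h3 fun h => h.2 ⟨d, rfl, hT h1⟩

namespace OGraph

variable {X : OGraph.{u}}

theorem not_transGen_adj (hX : X.di.IsAcyclic) (v : X.graph.V) :
    ¬ Relation.TransGen (X.orient.Adj (-1)) v v := by
  rw [Orientation.adj_neg_one]
  exact hX.not_transGen v

/-- A star could only cut a loop at `v`, or fail to be convex through a directed cycle at `v`. -/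
theorem star_mem_sSb (hX : X.di.IsAcyclic) (v : X.graph.V) : Emb.star v ∈ X.sSb := by
  rw [mem_sSb_iff hX]
  constructor
  · intro a ha haW
    rw [Emb.verts_star] at haW
    obtain ⟨d, hd, hdv⟩ := Emb.mem_bdry_star.1 ha
    obtain ⟨e, he, hev⟩ := haW
    obtain rfl : X.graph.t d = v := hdv
    have hev : X.graph.t e = X.graph.t d := hev
    have hde : X.graph.incl d = X.graph.inv (X.graph.incl e) := by rw [hd, he]
    rcases Int.units_eq_one_or (X.orient.sign a) with h | h
    · exact not_transGen_adj hX _ (.single ⟨e, d, hev, rfl, hde, by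
        rw [hd, X.orient.sign_inv', h]⟩)
    · exact not_transGen_adj hX _ (.single ⟨d, e, rfl, hev, by
        rw [hde, X.graph.inv_inv], by rw [he, h]⟩)
  · rw [Emb.verts_star]
    rintro v u w rfl rfl hvu huw
    rcases Relation.reflTransGen_iff_eq_or_transGen.1 hvu with h | h
    · exact h
    · exact (not_transGen_adj hX _ (h.trans_left huw)).elim

/-- The existence of a structured subgraph with given vertices. -/
theorem exists_mem_sSb (hX : X.di.IsAcyclic) {W : Set X.graph.V} (hn : W.Nonempty)
    (conn : ∀ T ⊆ W, T.Nonempty →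
      (∀ d d', X.graph.t d ∈ T → X.graph.t d' ∈ W →
        X.graph.incl d' = X.graph.inv (X.graph.incl d) → X.graph.t d' ∈ T) → T = W)
    (hc : X.orient.IsConvex W) : ∃ H ∈ X.sSb, H.verts = W := by
  obtain ⟨H, hV, hB⟩ := (isEmbData_full hn conn).exists_emb
  refine ⟨H, ?_, hV⟩
  rw [mem_sSb_iff hX, Emb.IsFull, hV, hB]
  exact ⟨fun a ha => ha.2, hc⟩

/-- A structured subgraph with at least two vertices is a union of two smaller structured subgraphs
without common vertices. -/
theorem exists_split (hX : X.di.IsAcyclic) {H : Emb X.graph} (hH : H ∈ X.sSb)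
    (hn : H.verts.Nontrivial) : ∃ H₁ ∈ X.sSb, ∃ H₂ ∈ X.sSb, H₁.verts.Nonempty ∧
      H₂.verts.Nonempty ∧ H₁.verts ∩ H₂.verts = ∅ ∧ H.verts = H₁.verts ∪ H₂.verts := by
  rw [mem_sSb_iff hX] at hH
  obtain ⟨hf, hc⟩ := hH
  have hconn : ∀ T ⊆ H.verts, T.Nonempty → (∀ d d', X.graph.t d ∈ T → X.graph.t d' ∈ H.verts →
      X.graph.incl d' = X.graph.inv (X.graph.incl d) → X.graph.t d' ∈ T) → T = H.verts :=
    fun T hT hTn hcl => (Emb.isEmbData hn.nonempty).conn T hT hTn fun d d' h1 h2 h3 _ =>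
      hcl d d' h1 h2 h3
  -- `s` is a source of `H`. The pieces are a connected component `Z` of `H` without `s`, and the
  -- rest.
  obtain ⟨s, hs, hmin⟩ := (X.orient.wellFounded_adj hX (-1)).has_min H.verts hn.nonempty
  obtain ⟨z, hz, hzs⟩ := hn.exists_ne s
  let r : X.graph.V → X.graph.V → Prop := fun v w => (v ∈ H.verts ∧ v ≠ s) ∧
    (w ∈ H.verts ∧ w ≠ s) ∧ ∃ d d', X.graph.t d = v ∧ X.graph.t d' = w ∧
      X.graph.incl d' = X.graph.inv (X.graph.incl d)
  have hr : Std.Symm r := ⟨by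
    rintro v w ⟨h1, h2, d, d', h3, h4, h5⟩
    exact ⟨h2, h1, d', d, h4, h3, by rw [h5, X.graph.inv_inv]⟩⟩
  set Z : Set X.graph.V := {v | Relation.ReflTransGen r z v} with hZdef
  have hzZ : z ∈ Z := Relation.ReflTransGen.refl
  have hZ : ∀ v ∈ Z, v ∈ H.verts ∧ v ≠ s := by
    intro v hv
    rcases Relation.ReflTransGen.cases_tail hv with rfl | ⟨w, -, hw⟩
    · exact ⟨hz, hzs⟩
    · exact hw.2.1
  have hZcl : ∀ d d', X.graph.t d ∈ Z → X.graph.t d' ∈ H.verts → X.graph.t d' ≠ s →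
      X.graph.incl d' = X.graph.inv (X.graph.incl d) → X.graph.t d' ∈ Z :=
    fun d d' h1 h2 h3 h4 =>
      Relation.ReflTransGen.tail h1 ⟨hZ _ h1, ⟨h2, h3⟩, d, d', rfl, rfl, h4⟩
  -- Within `H`, the set `Z` can be left only through `s`, and no edge of `H` enters `s`. Convexity
  -- of both pieces rests on this.
  have hstep : ∀ {v w}, v ∈ Z → w ∈ H.verts → X.orient.Adj (-1) v w → w ∈ Z := by
    rintro _ _ hv hw ⟨d, d', rfl, rfl, hi, hsg⟩
    refine hZcl d d' hv hw (fun h => hmin _ (hZ _ hv).1 ⟨d, d', rfl, h, hi, hsg⟩) hi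
  obtain ⟨H₁, hH₁, hV₁⟩ := exists_mem_sSb hX (W := Z) ⟨z, hzZ⟩ (by
    intro T hT ⟨x, hx⟩ hcl
    refine hT.antisymm fun y hy => ?_
    have hxy : Relation.ReflTransGen r x y :=
      (Relation.ReflTransGen.stdSymm.symm _ _ (hT hx)).trans hy
    have hxZ : x ∈ Z := hT hx
    clear hy
    suffices y ∈ T ∧ y ∈ Z from this.1
    induction hxy with
    | refl => exact ⟨hx, hxZ⟩
    | tail _ h ih =>
      obtain ⟨-, h2, d, d', rfl, rfl, hi⟩ := h
      have hZ' := hZcl d d' ih.2 h2.1 h2.2 hi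
      exact ⟨hcl d d' ih.1 hZ' hi, hZ'⟩) (by
    intro v u w hv hw hvu huw
    induction hvu with
    | refl => exact hv
    | tail h0 h ih =>
      exact hstep (ih (huw.head h)) (hc v _ w (hZ v hv).1 (hZ w hw).1 (h0.tail h) huw) h)
  obtain ⟨H₂, hH₂, hV₂⟩ := exists_mem_sSb hX (W := H.verts \ Z) ⟨s, hs, fun h => (hZ s h).2 rfl⟩
    (by
      intro T hT hTn hcl
      -- Outside `Z` only `s` is adjacent to `Z`. If `T` contains `s`, then `T ∪ Z` is closed in
      -- `H`; otherwise `T` itself would be.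
      by_cases hsT : s ∈ T
      · have h1 : T ∪ Z = H.verts := by
          refine hconn _ (Set.union_subset (hT.trans Set.sdiff_subset) fun v hv => (hZ v hv).1)
            hTn.inl ?_
          rintro d d' (hd | hd) hd' hi
          · by_cases h : X.graph.t d' ∈ Z
            · exact Or.inr h
            · exact Or.inl (hcl d d' hd ⟨hd', h⟩ hi)
          · by_cases h : X.graph.t d' = s
            · exact Or.inl (h ▸ hsT)
            · exact Or.inr (hZcl d d' hd hd' h hi)
        refine hT.antisymm fun v hv => ?_
        rw [← h1] at hv
        exact hv.1.resolve_right hv.2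
      · have h1 : T = H.verts := by
          refine hconn T (hT.trans Set.sdiff_subset) hTn fun d d' hd hd' hi => ?_
          refine hcl d d' hd ⟨hd', fun h => ?_⟩ hi
          refine (hT hd).2 (hZcl d' d h (hT hd).1 (fun h' => hsT (h' ▸ hd)) ?_)
          rw [hi, X.graph.inv_inv]
        exact (hsT (h1 ▸ hs)).elim)
    (by
      intro v u w hv hw hvu huw
      refine ⟨hc v u w hv.1 hw.1 hvu huw, fun hu => hw.2 ?_⟩
      induction huw with
      | refl => exact hu
      | @tail y w h0 h ih =>
        have hy := hc v y w hv.1 hw.1 (hvu.trans h0) (.single h)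
        by_cases hyZ : y ∈ Z
        · exact hstep hyZ hw.1 h
        · exact (hyZ (ih ⟨hy, hyZ⟩)).elim)
  refine ⟨H₁, hH₁, H₂, hH₂, hV₁ ▸ ⟨z, hzZ⟩, hV₂ ▸ ⟨s, hs, fun h => (hZ s h).2 rfl⟩, ?_, ?_⟩
  · rw [hV₁, hV₂, Set.inter_sdiff_self]
  · rw [hV₁, hV₂, Set.union_sdiff_cancel fun v hv => (hZ v hv).1]

end OGraph

/-! ### Extending a properadic map to all embeddings -/

namespace GHom

variable {X Y : AcyclicGraph.{u}} (ψ : GHom X Y)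

theorem exists_arc (a : X.graph.graph.A) : ∃ b, Edge.mk Y.graph.graph b =
    ψ.edge (Edge.mk X.graph.graph a) ∧ Y.graph.orient.sign b = X.graph.orient.sign a := by
  obtain ⟨b, hb⟩ := Quotient.exists_rep (ψ.edge (Edge.mk X.graph.graph a))
  by_cases h : Y.graph.orient.sign b = X.graph.orient.sign a
  · exact ⟨b, hb, h⟩
  · refine ⟨Y.graph.graph.inv b, (Edge.mk_eq_iff.2 (Or.inr rfl)).trans hb, ?_⟩
    rw [Y.graph.orient.sign_inv', ← Int.units_ne_iff_eq_neg.1 (Ne.symm h)]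

/-- The map on arcs which lifts the map on edges and preserves signs. -/
noncomputable def arc (a : X.graph.graph.A) : Y.graph.graph.A := (ψ.exists_arc a).choose

theorem mk_arc (a : X.graph.graph.A) :
    Edge.mk Y.graph.graph (ψ.arc a) = ψ.edge (Edge.mk X.graph.graph a) :=
  (ψ.exists_arc a).choose_spec.1

theorem sign_arc (a : X.graph.graph.A) :
    Y.graph.orient.sign (ψ.arc a) = X.graph.orient.sign a :=
  (ψ.exists_arc a).choose_spec.2

theorem arc_inv (a : X.graph.graph.A) :
    ψ.arc (X.graph.graph.inv a) = Y.graph.graph.inv (ψ.arc a) := by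
  refine Y.graph.orient.eq_of_mk_eq ?_ ?_
  · rw [mk_arc, Edge.mk_eq_iff.2 (Or.inr rfl : X.graph.graph.inv a = a ∨ _), ← mk_arc]
    exact (Edge.mk_eq_iff.2 (Or.inr rfl)).symm
  · rw [sign_arc, Orientation.sign_inv', Orientation.sign_inv', sign_arc]

theorem edge_map_arc : Edge.map ψ.arc ψ.arc_inv = ψ.edge := by
  funext e
  induction e using Quotient.inductionOn with
  | _ a => exact ψ.mk_arc a

/-- The two signs split the boundary into inputs and outputs, and for each sign edges determine
arcs. -/
theorem bijOn_bdry (H : X.graph.sSb) :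
    Set.BijOn ψ.arc (H : Emb X.graph.graph).bdry (ψ.check H : Emb Y.graph.graph).bdry := by
  have key : ∀ s : ℤˣ, Set.BijOn ψ.edge
      (Edge.mk X.graph.graph '' {a | a ∈ (H : Emb X.graph.graph).bdry ∧ X.graph.orient.sign a = s})
      (Edge.mk Y.graph.graph ''
        {a | a ∈ (ψ.check H : Emb Y.graph.graph).bdry ∧ Y.graph.orient.sign a = s}) := by
    intro s
    rcases Int.units_eq_one_or s with rfl | rfl
    · exact ψ.inp H
    · exact ψ.out H
  refine ⟨fun a ha => ?_, fun a ha b hb hab => ?_, fun b hb => ?_⟩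
  · obtain ⟨b, ⟨hb, hbs⟩, hba⟩ := (key _).mapsTo ⟨a, ⟨ha, rfl⟩, rfl⟩
    rwa [← Y.graph.orient.eq_of_mk_eq (hba.trans (ψ.mk_arc a).symm)
      (hbs.trans (ψ.sign_arc a).symm)]
  · have hs : X.graph.orient.sign a = X.graph.orient.sign b := by
      rw [← ψ.sign_arc, hab, ψ.sign_arc]
    refine X.graph.orient.eq_of_mk_eq ((key _).injOn ⟨a, ⟨ha, hs⟩, rfl⟩ ⟨b, ⟨hb, rfl⟩, rfl⟩ ?_) hs
    rw [← mk_arc, ← mk_arc, hab]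
  · obtain ⟨_, ⟨a, ⟨ha, has⟩, rfl⟩, hab⟩ := (key _).surjOn ⟨b, ⟨hb, rfl⟩, rfl⟩
    exact ⟨a, ha, Y.graph.orient.eq_of_mk_eq ((ψ.mk_arc a).trans hab)
      ((ψ.sign_arc a).trans has)⟩

theorem isFull_check (H : X.graph.sSb) : (ψ.check H : Emb Y.graph.graph).IsFull :=
  ((OGraph.mem_sSb_iff Y.acyclic).1 (ψ.check H).2).1

theorem isFull_sSb (H : X.graph.sSb) : (H : Emb X.graph.graph).IsFull :=
  ((OGraph.mem_sSb_iff X.acyclic).1 H.2).1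

/-- The boundary of the image contains two opposite arcs. With a vertex present, this would be a cut
edge, against fullness. -/
theorem verts_check_of_empty {H : X.graph.sSb} (hH : (H : Emb X.graph.graph).verts = ∅) :
    (ψ.check H : Emb Y.graph.graph).verts = ∅ := by
  by_contra hc
  obtain ⟨a, ha, -⟩ := Emb.exists_edge hH
  have hm := (ψ.bijOn_bdry H).mapsTo
  rw [ha] at hm
  have h1 := hm (Or.inl rfl)
  have h2 := hm (Or.inr rfl)
  rw [ψ.arc_inv] at h2
  exact ψ.isFull_check H _ h2
    ((Emb.isEmbData (Set.nonempty_iff_ne_empty.2 hc)).inv_mem _ h1)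

theorem isUnion_check {J H₁ H₂ : X.graph.sSb} (hu : Emb.IsUnion J.1 H₁.1 H₂.1) :
    Emb.IsUnion (ψ.check J : Emb Y.graph.graph) (ψ.check H₁).1 (ψ.check H₂).1 :=
  OGraph.isUnion_of_image_eq (ψ.isFull_check J)
    (ψ.union H₁ H₂ J (OGraph.image_eq_of_isUnion hu))

/-- Otherwise some uncut edge of the image of `H₁` leaves the image of `H₂`. It comes from a
boundary arc of `H₂`, which is not in the boundary of `J` because the image of `J` is full, so its
edge joins `H₂` to `H₁`. Then `H₁` has it in its boundary, and the image of `H₁` would cut the edge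
after all. -/
theorem verts_check_subset {J H₁ H₂ : X.graph.sSb} (hu : Emb.IsUnion J.1 H₁.1 H₂.1)
    (hd : H₁.1.verts ∩ H₂.1.verts = ∅) (hn : H₁.1.verts.Nonempty)
    (hn₂ : H₂.1.verts.Nonempty)
    (hne : ((ψ.check H₁).1.verts ∩ (ψ.check H₂).1.verts).Nonempty) :
    (ψ.check H₁).1.verts ⊆ (ψ.check H₂).1.verts := by
  have hn' : (ψ.check H₁).1.verts.Nonempty := hne.mono Set.inter_subset_left
  have hn₂' : (ψ.check H₂).1.verts.Nonempty := hne.mono Set.inter_subset_right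
  by_contra hc
  obtain ⟨d, d', hd1, hd2, hd3, hi, -⟩ := (Emb.isEmbData hn').exists_step Set.inter_subset_left hne
    (fun h => hc (Set.inter_eq_left.1 h))
  have hc : Y.graph.graph.incl d' ∈ (ψ.check H₂).1.bdry := by
    by_contra h
    rw [hi] at h
    have := ((Emb.isEmbData hn₂').inner _ ⟨d, rfl, hd1.2⟩ h).1
    rw [← hi] at this
    exact hd3 ⟨hd2, incl_mem_att.1 this⟩
  obtain ⟨g, hg, hgd⟩ := (ψ.bijOn_bdry H₂).surjOn hc
  have hJ : g ∉ J.1.bdry := fun h => by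
    refine ψ.isFull_check J _ ((ψ.bijOn_bdry J).mapsTo h) ?_
    rw [hgd, (ψ.isUnion_check hu).2.2]
    exact att_union.2 (Or.inl ⟨d', rfl, hd2⟩)
  have hg₂ := (Emb.isEmbData hn₂).inv_mem _ hg
  have hgJ : g ∈ X.graph.graph.att J.1.verts := by
    have := ((Emb.isEmbData (hu.2.2 ▸ hn.inl)).inner (X.graph.graph.inv g)
      (by rw [hu.2.2]; exact att_union.2 (Or.inr hg₂)) (by rwa [X.graph.graph.inv_inv])).1
    rwa [X.graph.graph.inv_inv] at this
  rw [hu.2.2, att_union] at hgJ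
  have hg₁ := hgJ.resolve_right (isFull_sSb H₂ g hg)
  have hgb : X.graph.graph.inv g ∈ H₁.1.bdry := by
    by_contra h
    exact not_mem_att_empty (hd ▸ att_inter ((Emb.isEmbData hn).inner g hg₁ h).1 hg₂)
  have := (ψ.bijOn_bdry H₁).mapsTo hgb
  rw [ψ.arc_inv, hgd, hi, Y.graph.graph.inv_inv] at this
  exact ψ.isFull_check H₁ _ this ⟨d, rfl, hd1.1⟩

/-- Properadic maps preserve vertex disjointness of pairs whose union is a structured subgraph. -/
theorem verts_check_inter {J H₁ H₂ : X.graph.sSb} (hu : Emb.IsUnion J.1 H₁.1 H₂.1)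
    (hd : H₁.1.verts ∩ H₂.1.verts = ∅) (hn : H₁.1.verts.Nonempty)
    (hn₂ : H₂.1.verts.Nonempty) : (ψ.check H₁).1.verts ∩ (ψ.check H₂).1.verts = ∅ := by
  by_contra hc
  have hne := Set.nonempty_iff_ne_empty.2 hc
  have heq : (ψ.check H₁).1.verts = (ψ.check H₂).1.verts :=
    (ψ.verts_check_subset hu hd hn hn₂ hne).antisymm (ψ.verts_check_subset (J := J)
      ⟨hu.2.1, hu.1, hu.2.2.trans (Set.union_comm _ _)⟩ (by rwa [Set.inter_comm]) hn₂ hn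
      (by rwa [Set.inter_comm]))
  have hJ : J.1.verts.Nonempty := hu.2.2 ▸ hn.inl
  -- Since `J` is connected, an edge joins `H₁` to `H₂`. Both images have the same vertices, so both
  -- ends of its image are attached to them, although it lies in the boundary of each.
  obtain ⟨d, d', h1, h2, h3, h4, -⟩ := (Emb.isEmbData hJ).exists_step
    (Emb.verts_subset_of_le hu.1) hn (fun h => by
      obtain ⟨v, hv⟩ := hn₂
      have : v ∈ H₁.1.verts := h ▸ Emb.verts_subset_of_le hu.2.1 hv
      exact Set.eq_empty_iff_forall_notMem.1 hd v ⟨this, hv⟩)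
  have h2' : X.graph.graph.t d' ∈ H₂.1.verts := (hu.2.2 ▸ h2).resolve_left h3
  have hb₁ : X.graph.graph.incl d' ∈ H₁.1.bdry := by
    by_contra h
    rw [h4] at h
    have := ((Emb.isEmbData hn).inner _ ⟨d, rfl, h1⟩ h).1
    rw [← h4] at this
    exact h3 (incl_mem_att.1 this)
  have hb₂ : X.graph.graph.incl d ∈ H₂.1.bdry := by
    by_contra h
    have h5 := ((Emb.isEmbData hn₂).inner (X.graph.graph.incl d') ⟨d', rfl, h2'⟩
      (by rwa [h4, X.graph.graph.inv_inv])).1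
    rw [h4, X.graph.graph.inv_inv] at h5
    exact Set.eq_empty_iff_forall_notMem.1 hd _ ⟨h1, incl_mem_att.1 h5⟩
  have e₁ := (Emb.isEmbData (hne.mono Set.inter_subset_left)).inv_mem _
    ((ψ.bijOn_bdry H₁).mapsTo hb₁)
  rw [← ψ.arc_inv, h4, X.graph.graph.inv_inv, heq] at e₁
  exact ψ.isFull_check H₂ _ ((ψ.bijOn_bdry H₂).mapsTo hb₂) e₁

/-- The value of a properadic map at the star of a vertex. -/
noncomputable def star (v : X.graph.graph.V) : Emb Y.graph.graph :=
  ψ.check ⟨Emb.star v, OGraph.star_mem_sSb X.acyclic v⟩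

/-- Both claims go together by induction on the number of vertices, splitting `H` by
`OGraph.exists_split`; `verts_check_inter` treats vertices in different pieces. -/
theorem verts_check_and_disjoint (H : X.graph.sSb) :
    (ψ.check H).1.verts = ⋃ v ∈ H.1.verts, (ψ.star v).verts ∧
    ∀ v ∈ H.1.verts, ∀ w ∈ H.1.verts, v ≠ w → (ψ.star v).verts ∩ (ψ.star w).verts = ∅ := by
  have := X.graph.graph.finV
  suffices ∀ n (H : X.graph.sSb), H.1.verts.ncard = n →
      (ψ.check H).1.verts = ⋃ v ∈ H.1.verts, (ψ.star v).verts ∧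
      ∀ v ∈ H.1.verts, ∀ w ∈ H.1.verts, v ≠ w → (ψ.star v).verts ∩ (ψ.star w).verts = ∅ from
    this _ H rfl
  intro n
  induction n using Nat.strong_induction_on with
  | _ n ih =>
    intro H hH
    rcases H.1.verts.eq_empty_or_nonempty with hn | hn
    · rw [hn, ψ.verts_check_of_empty hn]
      simp
    rcases hn.exists_eq_singleton_or_nontrivial with ⟨v, hv⟩ | hnt
    · have : H = ⟨Emb.star v, OGraph.star_mem_sSb X.acyclic v⟩ := by
        refine Subtype.ext (Emb.ext_verts_bdry (by rw [hv, Emb.verts_star]) ?_)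
        refine (Emb.bdry_subset_of_le_of_verts_eq (k := Emb.star v) (Emb.star_le (by simp [hv]))
          hn (by simp [hv])).antisymm fun a ha => ?_
        by_contra hc
        have h1 : X.graph.graph.inv a ∈ X.graph.graph.att H.1.verts := by
          rw [hv]
          exact Emb.mem_bdry_star.1 ha
        have h2 := ((Emb.isEmbData hn).inner _ h1 (by rwa [X.graph.graph.inv_inv])).1
        rw [X.graph.graph.inv_inv, hv, ← Emb.verts_star v] at h2
        exact isFull_sSb ⟨Emb.star v, OGraph.star_mem_sSb X.acyclic v⟩ _ ha h2
      subst this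
      refine ⟨by simp [star], ?_⟩
      simp only [Emb.verts_star]
      rintro _ rfl _ rfl h
      exact (h rfl).elim
    · obtain ⟨H₁, h₁, H₂, h₂, n₁, n₂, hd, hV⟩ := OGraph.exists_split X.acyclic H.2 hnt
      have hu : Emb.IsUnion H.1 H₁ H₂ := ⟨(isFull_sSb H).le n₁ (hV ▸ Set.subset_union_left),
        (isFull_sSb H).le n₂ (hV ▸ Set.subset_union_right), hV⟩
      have lt₁ : H₁.verts.ncard < n := by
        rw [← hH, hV]
        refine Set.ncard_lt_ncard ⟨Set.subset_union_left, fun h => ?_⟩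
        obtain ⟨v, hv⟩ := n₂
        exact Set.eq_empty_iff_forall_notMem.1 hd v ⟨h (Or.inr hv), hv⟩
      have lt₂ : H₂.verts.ncard < n := by
        rw [← hH, hV]
        refine Set.ncard_lt_ncard ⟨Set.subset_union_right, fun h => ?_⟩
        obtain ⟨v, hv⟩ := n₁
        exact Set.eq_empty_iff_forall_notMem.1 hd v ⟨hv, h (Or.inl hv)⟩
      obtain ⟨a₁, b₁⟩ := ih _ lt₁ ⟨H₁, h₁⟩ rfl
      obtain ⟨a₂, b₂⟩ := ih _ lt₂ ⟨H₂, h₂⟩ rfl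
      have hx := ψ.verts_check_inter (J := H) (H₁ := ⟨H₁, h₁⟩) (H₂ := ⟨H₂, h₂⟩) hu hd n₁ n₂
      rw [a₁, a₂] at hx
      have hcross : ∀ v ∈ H₁.verts, ∀ w ∈ H₂.verts,
          (ψ.star v).verts ∩ (ψ.star w).verts = ∅ := fun v hv w hw =>
        Set.eq_empty_of_forall_notMem fun u hu => Set.eq_empty_iff_forall_notMem.1 hx u
          ⟨Set.mem_biUnion hv hu.1, Set.mem_biUnion hw hu.2⟩
      constructor
      · rw [(ψ.isUnion_check (J := H) (H₁ := ⟨H₁, h₁⟩) (H₂ := ⟨H₂, h₂⟩) hu).2.2, a₁, a₂, hV,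
          Set.biUnion_union]
      · rw [hV]
        rintro v (hv | hv) w (hw | hw) hvw
        · exact b₁ v hv w hw hvw
        · exact hcross v hv w hw
        · rw [Set.inter_comm]
          exact hcross w hw v hv
        · exact b₂ v hv w hw hvw

/-- The substitution data of a properadic map. -/
noncomputable def starMap : StarMap X.graph Y.graph where
  arc := ψ.arc
  arc_inv := ψ.arc_inv
  sign_arc := ψ.sign_arc
  star := ψ.star
  bdry v := ψ.bijOn_bdry ⟨Emb.star v, OGraph.star_mem_sSb X.acyclic v⟩
  disjoint v w hvw := (ψ.verts_check_and_disjoint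
    ⟨Emb.top X.graph.graph X.graph.U.conn, top_mem_sSb X.acyclic⟩).2 v (by simp) w (by simp) hvw

/-- The extension of a properadic map to a map in `U/𝔬`. -/
noncomputable def extend : X.graph ⟶ Y.graph where
  hom := ψ.starMap.toUHom X.acyclic
  orient := Orientation.ext (funext ψ.sign_arc)

/-- `check H` already has the vertices and boundary that substitution prescribes, and these
determine an embedding. -/
theorem hat_extend (H : X.graph.sSb) : ψ.extend.hom.hat H = (ψ.check H).1 :=
  (ψ.starMap.isImage_toUHom X.acyclic H.1).unique
    ⟨(ψ.verts_check_and_disjoint H).1, ψ.bijOn_bdry H⟩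

theorem extend_mem : ψ.extend.hom.hat (Emb.top X.graph.graph X.graph.U.conn) ∈ Y.graph.sSb := by
  have := ψ.hat_extend ⟨Emb.top X.graph.graph X.graph.U.conn, top_mem_sSb X.acyclic⟩
  exact this ▸ (ψ.check _).2

theorem restrict_extend : restrict ψ.extend ψ.extend_mem = ψ :=
  GHom.ext ψ.edge_map_arc (funext fun H => Subtype.ext (ψ.hat_extend H))

end GHom

/-! ### The isomorphism of categories -/

theorem restrict_injective {X Y : AcyclicGraph.{u}} {φ φ' : X.graph ⟶ Y.graph}
    {h : φ.hom.hat (Emb.top X.graph.graph X.graph.U.conn) ∈ Y.graph.sSb}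
    {h' : φ'.hom.hat (Emb.top X.graph.graph X.graph.U.conn) ∈ Y.graph.sSb}
    (heq : restrict φ h = restrict φ' h') : φ = φ' := by
  refine OHom.ext (UHom.ext_star (funext fun a => ?_) fun v => ?_)
  · refine Y.graph.orient.eq_of_mk_eq
      (congrFun (congrArg GHom.edge heq) (Edge.mk X.graph.graph a)) ?_
    rw [OHom.sign_arc φ, OHom.sign_arc φ']
  · exact congrArg Subtype.val (congrFun (congrArg GHom.check heq)
      ⟨Emb.star v, OGraph.star_mem_sSb X.acyclic v⟩)

theorem restrict_id (X : AcyclicGraph.{u})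
    (h : (𝟙 X.graph : X.graph ⟶ X.graph).hom.hat (Emb.top X.graph.graph X.graph.U.conn) ∈
      X.graph.sSb) : restrict (𝟙 X.graph) h = 𝟙 X :=
  GHom.ext (funext fun e => Quotient.inductionOn e fun _ => rfl) rfl

theorem restrict_comp {X Y Z : AcyclicGraph.{u}} (φ : X.graph ⟶ Y.graph) (ψ : Y.graph ⟶ Z.graph)
    (hφ : φ.hom.hat (Emb.top X.graph.graph X.graph.U.conn) ∈ Y.graph.sSb)
    (hψ : ψ.hom.hat (Emb.top Y.graph.graph Y.graph.U.conn) ∈ Z.graph.sSb)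
    (h : (φ ≫ ψ).hom.hat (Emb.top X.graph.graph X.graph.U.conn) ∈ Z.graph.sSb) :
    restrict (φ ≫ ψ) h = restrict φ hφ ≫ restrict ψ hψ :=
  GHom.ext (funext fun e => Quotient.inductionOn e fun _ => rfl) rfl

/-- For a composite, `OHom.hat_mem_sSb` is applied to the second map and to the image of `top` under
the first. -/
instance structuredMaps_isMultiplicative : structuredMaps.{u}.IsMultiplicative where
  id_mem X := top_mem_sSb X.property
  comp_mem {_ Y Z} _ g hf hg := OHom.hat_mem_sSb g.hom Y.property Z.property hg hf

/-- Restriction to structured subgraphs as a functor. -/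
def restriction : WideSubcategory structuredMaps.{u} ⥤ AcyclicGraph.{u} where
  obj X := AcyclicGraph.ofObj X.obj
  map {X Y} φ := restrict (X := AcyclicGraph.ofObj X.obj) (Y := AcyclicGraph.ofObj Y.obj)
    φ.hom.hom φ.property
  map_id X := restrict_id (AcyclicGraph.ofObj X.obj) _
  map_comp {X Y Z} φ ψ := restrict_comp (X := AcyclicGraph.ofObj X.obj)
    (Y := AcyclicGraph.ofObj Y.obj) (Z := AcyclicGraph.ofObj Z.obj) φ.hom.hom ψ.hom.hom
    φ.property ψ.property _

/-- The object of the category of structured maps given by an acyclic graph. -/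
def AcyclicGraph.toObj (X : AcyclicGraph.{u}) : WideSubcategory structuredMaps.{u} :=
  ⟨⟨X.graph, X.acyclic⟩⟩

/-- The extension of a properadic map as a structured map. -/
noncomputable def GHom.extendHom {X Y : AcyclicGraph.{u}} (ψ : X ⟶ Y) : X.toObj ⟶ Y.toObj :=
  ⟨⟨GHom.extend ψ⟩, GHom.extend_mem ψ⟩

theorem restriction_map_extendHom {X Y : AcyclicGraph.{u}} (ψ : X ⟶ Y) :
    restriction.map (GHom.extendHom ψ) = ψ :=
  GHom.restrict_extend ψ

instance : restriction.{u}.Faithful where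
  map_injective {X Y} f g h := by
    have h' : f.hom.hom = g.hom.hom := restrict_injective (X := AcyclicGraph.ofObj X.obj)
      (Y := AcyclicGraph.ofObj Y.obj) (h := f.property) (h' := g.property) h
    obtain ⟨⟨f⟩, hf⟩ := f
    obtain ⟨⟨g⟩, hg⟩ := g
    obtain rfl : f = g := h'
    rfl

/-- Extension of properadic maps as a functor. -/
noncomputable def extension : AcyclicGraph.{u} ⥤ WideSubcategory structuredMaps.{u} where
  obj X := X.toObj
  map ψ := GHom.extendHom ψ
  -- Functoriality is inherited from `restriction`, which is faithful and inverts the extension of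
  -- maps.
  map_id X := restriction.map_injective ((restriction_map_extendHom _).trans
    (restriction.map_id X.toObj).symm)
  map_comp φ ψ := restriction.map_injective (by
    rw [restriction.map_comp, restriction_map_extendHom, restriction_map_extendHom,
      restriction_map_extendHom]
    rfl)

end GraphCat

theorem mainTheorem5 :
    ∃ (_ : GraphCat.structuredMaps.{u}.IsMultiplicative)
      (F : WideSubcategory GraphCat.structuredMaps.{u} ⥤ GraphCat.AcyclicGraph.{u})
      (K : GraphCat.AcyclicGraph.{u} ⥤ WideSubcategory GraphCat.structuredMaps.{u}),
      F ⋙ K = 𝟭 _ ∧ K ⋙ F = 𝟭 _ ∧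
      ∃ hF : ∀ X, F.obj X = GraphCat.AcyclicGraph.ofObj X.obj,
        ∀ (X Y : WideSubcategory GraphCat.structuredMaps.{u}) (φ : X ⟶ Y),
          GraphCat.IsRestriction (X := GraphCat.AcyclicGraph.ofObj X.obj)
            (Y := GraphCat.AcyclicGraph.ofObj Y.obj) φ.hom.hom
            (eqToHom (hF X).symm ≫ F.map φ ≫ eqToHom (hF Y)) := by
  refine ⟨GraphCat.structuredMaps_isMultiplicative, GraphCat.restriction, GraphCat.extension,
    ?_, ?_, fun _ => rfl, fun X Y φ => ?_⟩
  · refine CategoryTheory.Functor.ext (fun _ => rfl) fun X Y f =>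
      GraphCat.restriction.map_injective (GraphCat.restriction_map_extendHom _)
  · refine CategoryTheory.Functor.ext (fun _ => rfl) fun X Y f =>
      GraphCat.restriction_map_extendHom f
  -- Objects agree definitionally, so the `eqToHom` factors are identities and disappear by
  -- reduction.
  · exact ⟨rfl, fun _ => rfl⟩
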